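/- **Proposition 3.6.** Let $n\ge 1$, $0<T\le\infty$ and $0\le\varepsilon\le\frac1n$. Let $X:\mathbb{S}^n\times[0,T)\to\mathbb{R}^{n+1}$ be a smooth family of immersions such that $X(\cdot,0)$ is an embedding, with smooth unit normal field $\nu$ along $X$ which at $t=0$ is the outward unit normal of the embedded hypersurface $M_0=X(\mathbb{S}^n,0)$. Let $g_{ij}=\langle\partial_iX,\partial_jX\rangle$ be the induced metric, $h_{ij}=\langle\partial_i\nu,\partial_jX\rangle$ the second fundamental form and $H=g^{ij}h_{ij}$ the mean curvature of $M_t=X(\mathbb{S}^n,t)$. (i) Suppose that $X$ is a solution of the inverse mean curvature flow, that is, $H\neq0$ everywhere and $$\frac{\partial X}{\partial t}=\frac1H\,\nu\qquad\text{on }\mathbb{S}^n\times[0,T).$$ If $h_{ij}\ge\varepsilon Hg_{ij}$ (as an inequality of symmetric bilinear forms) at every point of $M_0$, then $h_{ij}\ge\varepsilon Hg_{ij}$ at every point of $M_t$ for all $t\in[0,T)$, with the same $\varepsilon$. (ii) The same holds if $X$ is instead a solution of the rescaled inverse mean curvature flow, that is, $H\neq0$ everywhere and $$\frac{\partial X}{\partial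 t}=-\frac1n\,X+\frac1H\,\nu\qquad\text{on }\mathbb{S}^n\times[0,T).$$ -/

import Mathlib

open Set Filter Topology Manifold
open scoped ContDiff InnerProductSpace

/-- Euclidean space `ℝ^{n+1}`. -/
abbrev Ambient (n : ℕ) : Type := EuclideanSpace ℝ (Fin (n + 1))

/-- The unit sphere `S^n` in `ℝ^{n+1}`, with Mathlib's smooth manifold structure. -/
abbrev UnitSphere (n : ℕ) : Type := Metric.sphere (0 : Ambient n) 1

/-- The `i`-th coordinate vector `∂/∂x_i` at `x`, in the preferred chart of `S^n` at `x`. -/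
noncomputable def coordVec (n : ℕ) (x : UnitSphere n) (i : Fin n) : TangentSpace (𝓡 n) x :=
  (EuclideanSpace.single i 1 : EuclideanSpace ℝ (Fin n))

/-- The induced metric `g(v, w) = ⟨dF v, dF w⟩` of a map `F : S^n → ℝ^{n+1}`. -/
noncomputable def inducedMetric {n : ℕ} (F : UnitSphere n → Ambient n) (x : UnitSphere n)
    (v w : TangentSpace (𝓡 n) x) : ℝ :=
  ⟪mvfderiv (𝓡 n) F x v, mvfderiv (𝓡 n) F x w⟫_ℝ

/-- The second fundamental form `h(v, w) = ⟨dν v, dF w⟩` of `F` with respect to the unit normal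
field `ν`. With this sign, round spheres have `h > 0` with respect to the outward normal. -/
noncomputable def secondFundForm {n : ℕ} (F ν : UnitSphere n → Ambient n) (x : UnitSphere n)
    (v w : TangentSpace (𝓡 n) x) : ℝ :=
  ⟪mvfderiv (𝓡 n) ν x v, mvfderiv (𝓡 n) F x w⟫_ℝ

/-- The matrix `(g_ij)` of the induced metric in the coordinates of the preferred chart at `x`. -/
noncomputable def metricMatrix {n : ℕ} (F : UnitSphere n → Ambient n) (x : UnitSphere n) :
    Matrix (Fin n) (Fin n) ℝ :=
  Matrix.of fun i j => inducedMetric F x (coordVec n x i) (coordVec n x j)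

/-- The matrix `(h_ij)` of the second fundamental form in the same coordinates. -/
noncomputable def secondFundMatrix {n : ℕ} (F ν : UnitSphere n → Ambient n) (x : UnitSphere n) :
    Matrix (Fin n) (Fin n) ℝ :=
  Matrix.of fun i j => secondFundForm F ν x (coordVec n x i) (coordVec n x j)

/-- The mean curvature `H = g^{ij} h_ij`, the trace of `h` with respect to `g` (the sum of the
principal curvatures). It does not depend on the coordinates when `F` is an immersion. -/
noncomputable def meanCurv {n : ℕ} (F ν : UnitSphere n → Ambient n) (x : UnitSphere n) : ℝ :=
  ((metricMatrix F x)⁻¹ * secondFundMatrix F ν x).trace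

/-- The tensor inequality `h_ij ≥ ε H g_ij` at every point of the hypersurface. -/
def IsPinched {n : ℕ} (ε : ℝ) (F ν : UnitSphere n → Ambient n) : Prop :=
  ∀ (x : UnitSphere n) (v : TangentSpace (𝓡 n) x),
    ε * meanCurv F ν x * inducedMetric F x v v ≤ secondFundForm F ν x v v

/-- The union of the bounded components of the complement of `S`. -/
def boundedSide {n : ℕ} (S : Set (Ambient n)) : Set (Ambient n) :=
  {y | y ∈ Sᶜ ∧ Bornology.IsBounded (connectedComponentIn Sᶜ y)}

/-- The union of the unbounded components of the complement of `S`. -/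
def unboundedSide {n : ℕ} (S : Set (Ambient n)) : Set (Ambient n) :=
  {y | y ∈ Sᶜ ∧ ¬ Bornology.IsBounded (connectedComponentIn Sᶜ y)}

/-- The field `ν` along the closed embedded hypersurface `F` points outward: it points out of the
domain enclosed by the hypersurface and into the exterior. -/
def PointsOutward {n : ℕ} (F ν : UnitSphere n → Ambient n) : Prop :=
  ∀ x : UnitSphere n,
    (∀ᶠ s in 𝓝[>] (0 : ℝ), F x + s • ν x ∈ unboundedSide (range F)) ∧
    (∀ᶠ s in 𝓝[>] (0 : ℝ), F x - s • ν x ∈ boundedSide (range F))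

/-- The time interval `[0, T)`, where `T = ∞` is allowed. -/
def timeInterval (T : EReal) : Set ℝ := {t | 0 ≤ t ∧ (t : EReal) < T}

/-- A smooth family of immersed hypersurfaces `X t : S^n → ℝ^{n+1}`, `t ∈ [0, T)`, starting from
an embedded one, with the smooth family `ν t` of unit normal fields that is outward at `t = 0`
(by continuity in `t` it is the outward one for as long as `X t` stays embedded). -/
structure IsEvolvingHypersurface (n : ℕ) (T : EReal) (X ν : ℝ → UnitSphere n → Ambient n) :
    Prop where
  smooth : ContMDiffOn (𝓘(ℝ, ℝ).prod (𝓡 n)) 𝓘(ℝ, Ambient n) ∞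
    (fun p : ℝ × UnitSphere n => X p.1 p.2) (timeInterval T ×ˢ univ)
  smooth_normal : ContMDiffOn (𝓘(ℝ, ℝ).prod (𝓡 n)) 𝓘(ℝ, Ambient n) ∞
    (fun p : ℝ × UnitSphere n => ν p.1 p.2) (timeInterval T ×ˢ univ)
  immersion : ∀ t ∈ timeInterval T, ∀ x, Function.Injective (mvfderiv (𝓡 n) (X t) x)
  embedding_zero : IsEmbedding (X 0)
  norm_normal : ∀ t ∈ timeInterval T, ∀ x, ‖ν t x‖ = 1
  normal : ∀ t ∈ timeInterval T, ∀ x, ∀ v : TangentSpace (𝓡 n) x,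
    ⟪mvfderiv (𝓡 n) (X t) x v, ν t x⟫_ℝ = 0
  outward_zero : PointsOutward (X 0) (ν 0)

/-- `X` is a smooth solution on `[0, T)` of the inverse mean curvature flow `∂X/∂t = (1/H) ν`
(at `t = 0` the derivative is one-sided). -/
structure IsInverseMeanCurvatureFlow (n : ℕ) (T : EReal) (X ν : ℝ → UnitSphere n → Ambient n) :
    Prop extends IsEvolvingHypersurface n T X ν where
  meanCurv_ne_zero : ∀ t ∈ timeInterval T, ∀ x, meanCurv (X t) (ν t) x ≠ 0
  evolution : ∀ t ∈ timeInterval T, ∀ x,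
    HasDerivWithinAt (fun s => X s x) ((meanCurv (X t) (ν t) x)⁻¹ • ν t x) (timeInterval T) t

/-- `X` is a smooth solution on `[0, T)` of the rescaled inverse mean curvature flow
`∂X/∂t = -(1/n) X + (1/H) ν`. -/
structure IsRescaledInverseMeanCurvatureFlow (n : ℕ) (T : EReal)
    (X ν : ℝ → UnitSphere n → Ambient n) : Prop extends IsEvolvingHypersurface n T X ν where
  meanCurv_ne_zero : ∀ t ∈ timeInterval T, ∀ x, meanCurv (X t) (ν t) x ≠ 0
  evolution : ∀ t ∈ timeInterval T, ∀ x,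
    HasDerivWithinAt (fun s => X s x)
      (-(1 / (n : ℝ)) • X t x + (meanCurv (X t) (ν t) x)⁻¹ • ν t x) (timeInterval T) t

/-! Both flows have the form `∂X/∂t = ν/H - κX`, with `κ = 0` or `κ = 1/n`, and `κ` drops out of the
evolution of the pinching form `h - ηHg` at a null vector. So one argument, a tensor maximum
principle, serves both.

Suppose `H > 0`, put `η(t) = ε - δ exp(Ct)`, and let `ξ` be a unit tangent vector at which `h - ηHg`
first vanishes. By minimality `ξ` is an eigenvector of the shape operator. For any field `Ξ`
extending `ξ`, the function `G = (h - ηHg)(Ξ, Ξ)` satisfies `∂G/∂t ≤ 0 ≤ ΔG` at the contact point.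
By the evolution equations and Simons' identity, the second derivatives of `H` cancel in `H³ ∂G/∂t -
H ΔG`. What remains is a reaction term `2ηH²(|A|² - ηH²)`, nonnegative for `0 ≤ η ≤ 1/n` by
Cauchy–Schwarz, and gradient terms `-2(∇_ξ H)² + 2η|∇H|²`, which may be negative. The decisive point
is the choice of `Ξ`: its tangential derivative is taken to be `k` times the tangential projection.
This adds to `ΔG` a quadratic polynomial in `k`, and minimizing over `k` gains `2(1-η)²/(1-nη) (∇_ξ
H)²`, which outweighs the deficit (`IsSurfaceFrame.eval_laplacian_pinch`,
`IsInverseCurvatureFlow.eval_deriv_time_pinch`, `contact_impossible`). The perturbation makes `nη <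
1`, so the minimum exists, and supplies a strictly positive term that also absorbs the errors when
`η < 0`. Then `δ → 0` (`IsFlowFamily.no_first_contact`, `IsFlowFamily.pinchAt_nonneg`).

On connected space-time `H` has a constant sign. If `H < 0`, the trace `(1-nε)H` of the nonnegative
initial form forces `nε = 1`; a nonnegative form of trace zero vanishes, so the condition is
symmetric under `ν ↦ -ν`, and replacing `ν` by `-ν` leads back to `H > 0`
(`IsImmersedFamily.isPinched`).

To avoid charts, maps on the sphere are extended constantly along rays to `ℝ^{n+1} ∖ 0`, and the
frame is completed by sending the radial direction to the normal. The ambient basis then pulls back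
to vector fields `D a`, and the tensor calculus becomes algebra in a commutative ring with
derivations. -/

/-- Algebraic model of the tangential (Günter) derivatives of a hypersurface with position `X`,
unit normal `N`: `D a` is the tangential derivative in the `a`-th ambient direction, and `ρ` is an
auxiliary function transversal to the surface parameters. -/
structure IsSurfaceFrame {ι R : Type*} [Fintype ι] [DecidableEq ι] [CommRing R] [Algebra ℝ R]
    (D : ι → Derivation ℝ R R) (X N : ι → R) (ρ : R) : Prop where
  deriv_pos : ∀ a b, D a (X b) = (if a = b then 1 else 0) - N a * N b
  deriv_rho : ∀ a, D a ρ = N a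
  norm : ∑ a, N a * N a = 1
  comm : ∀ a b F, D a (D b F) - D b (D a F) =
    ∑ c, ((D a (D b (X c)) - D b (D a (X c))) + N c * (D a (D b ρ) - D b (D a ρ))) * D c F

/-! ### Codazzi and Simons identities for tangential derivatives -/

namespace IsSurfaceFrame

variable {ι R : Type*} [Fintype ι] [DecidableEq ι] [CommRing R] [Algebra ℝ R]
  {D : ι → Derivation ℝ R R} {X N : ι → R} {ρ : R}

lemma eq_zero_of_two_mul {x : R} (h : x + x = 0) : x = 0 := by
  have : (2 : ℝ) • x = 0 := by rw [two_smul, h]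
  simpa [smul_smul] using congrArg (fun y => (2 : ℝ)⁻¹ • y) this

omit [DecidableEq ι] in
lemma sum_normal_mul_deriv {E : Derivation ℝ R R} (h : ∑ a, N a * N a = 1) :
    ∑ b, N b * E (N b) = 0 := by
  have h := congrArg E h
  rw [map_sum, Derivation.map_one_eq_zero] at h
  simp only [Derivation.leibniz, smul_eq_mul, Finset.sum_add_distrib] at h
  exact eq_zero_of_two_mul h

lemma deriv_ite (E : Derivation ℝ R R) (p : Prop) [Decidable p] :
    E (if p then (1 : R) else 0) = 0 := by
  split_ifs <;> simp

/-- The square of the shape operator. -/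
def shapeSq (D : ι → Derivation ℝ R R) (N : ι → R) (a b : ι) : R := ∑ c, D a (N c) * D c (N b)

/-- The mean curvature, as the trace of the shape operator. -/
def meanCurvature (D : ι → Derivation ℝ R R) (N : ι → R) : R := ∑ a, D a (N a)

/-- The squared norm of the second fundamental form. -/
def normSq (D : ι → Derivation ℝ R R) (N : ι → R) : R := ∑ a, ∑ b, D a (N b) * D a (N b)

variable (hS : IsSurfaceFrame D X N ρ)
include hS

lemma sum_normal_mul (a : ι) : ∑ b, N b * D a (N b) = 0 := sum_normal_mul_deriv hS.norm

lemma sum_mul_normal (a : ι) : ∑ b, D a (N b) * N b = 0 := by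
  simpa only [mul_comm] using hS.sum_normal_mul a

/-- The `ρ` part of the commutator cancels exactly the multiples of `N c` produced by
differentiating the projection `D a (X c)`. -/
lemma comm_normal (a b : ι) (F : R) : D a (D b F) - D b (D a F) =
    ∑ c, (N a * D b (N c) - N b * D a (N c)) * D c F := by
  rw [hS.comm]
  refine Finset.sum_congr rfl fun c _ => ?_
  simp only [hS.deriv_pos, hS.deriv_rho, map_sub, deriv_ite, Derivation.leibniz, smul_eq_mul]
  ring

/-- Since `D a ρ = N a`, this is the commutator applied to `ρ`; its right-hand side vanishes because
`|N|² = 1`. -/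
lemma shape_symm (a b : ι) : D a (N b) = D b (N a) := by
  have h := hS.comm_normal a b ρ
  simp only [hS.deriv_rho, sub_mul, Finset.sum_sub_distrib, mul_assoc, ← Finset.mul_sum,
    hS.sum_mul_normal] at h
  simpa [sub_eq_zero] using h

lemma sum_normal_deriv_normal (b : ι) : ∑ a, N a * D a (N b) = 0 := by
  simp_rw [fun a => hS.shape_symm a b]
  exact hS.sum_normal_mul b

/-- The Codazzi equation: the commutator applied to a component of the normal. The terms with
`shapeSq` carry a factor of `N` because ambient indices are used. -/
lemma comm_shape (c a b : ι) : D c (D a (N b)) =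
    D a (D c (N b)) + N c * shapeSq D N a b - N a * shapeSq D N c b := by
  have h := hS.comm_normal c a (N b)
  simp only [sub_mul, Finset.sum_sub_distrib, mul_assoc, ← Finset.mul_sum] at h
  rw [shapeSq, shapeSq]
  linear_combination h

lemma sum_normal_shapeSq (b : ι) : ∑ c, N c * shapeSq D N c b = 0 := by
  simp only [shapeSq, Finset.mul_sum, ← mul_assoc]
  rw [Finset.sum_comm]
  simp only [← Finset.sum_mul, hS.sum_normal_deriv_normal]
  simp

lemma shapeSq_symm (a b : ι) : shapeSq D N a b = shapeSq D N b a := by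
  simp only [shapeSq]
  refine Finset.sum_congr rfl fun c _ => ?_
  rw [hS.shape_symm a c, hS.shape_symm c b, mul_comm]

lemma sum_normal_deriv_deriv (e b : ι) :
    ∑ c, N c * D e (D c (N b)) = - shapeSq D N e b := by
  have h := congrArg (D e) (hS.sum_normal_deriv_normal b)
  simp only [map_sum, map_zero, Derivation.leibniz, smul_eq_mul, Finset.sum_add_distrib] at h
  rw [shapeSq]
  simp only [mul_comm (D e (N _))]
  linear_combination h

/-- The shape operator is constant in the direction transversal to the surface. -/
lemma sum_normal_deriv_shape (a b : ι) : ∑ c, N c * D c (D a (N b)) = 0 := by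
  have h : ∀ c, N c * D c (D a (N b)) =
      N c * D a (D c (N b)) + N c * N c * shapeSq D N a b - N a * (N c * shapeSq D N c b) := by
    intro c; rw [hS.comm_shape c a b]; ring
  simp only [h, Finset.sum_add_distrib, Finset.sum_sub_distrib, ← Finset.sum_mul, ← Finset.mul_sum,
    hS.norm, hS.sum_normal_shapeSq, hS.sum_normal_deriv_deriv a]
  ring

lemma sum_normal_deriv_meanCurvature : ∑ c, N c * D c (meanCurvature D N) = 0 := by
  simp only [meanCurvature, map_sum, Finset.mul_sum]
  rw [Finset.sum_comm]
  exact Finset.sum_eq_zero fun a _ => hS.sum_normal_deriv_shape a a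

lemma normSq_eq : normSq D N = ∑ a, shapeSq D N a a := by
  simp only [normSq, shapeSq]
  refine Finset.sum_congr rfl fun a _ => Finset.sum_congr rfl fun b _ => ?_
  rw [hS.shape_symm a b]

/-- The Laplacian of the normal (the traced Codazzi equation). -/
lemma laplacian_normal (b : ι) :
    ∑ a, D a (D a (N b)) = D b (meanCurvature D N) - N b * normSq D N := by
  have h : ∀ a, D a (D a (N b)) = D b (D a (N a)) + N a * shapeSq D N a b
      - N b * shapeSq D N a a := by
    intro a
    rw [hS.shape_symm a b, hS.comm_shape a b a, hS.shapeSq_symm b a]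
  simp only [h, Finset.sum_add_distrib, Finset.sum_sub_distrib, ← Finset.mul_sum,
    hS.sum_normal_shapeSq, ← hS.normSq_eq, ← map_sum]
  rw [meanCurvature]; ring

/-- Simons' identity, modulo terms that are multiples of the normal. -/
lemma simons : ∃ U V : ι → R, ∀ a b, ∑ c, D c (D c (D a (N b))) =
    D a (D b (meanCurvature D N)) - normSq D N * D a (N b) + meanCurvature D N * shapeSq D N a b
      - 2 * ∑ c, D a (N c) * shapeSq D N c b + N a * U b + N b * V a := by
  -- `U` and `V` collect whatever comes with a free factor `N a` or `N b`; contraction with tangent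
  -- vectors kills them. The main terms come from applying Codazzi, commuting `D c` past `D a`, and
  -- inserting the Laplacian of the normal.
  refine ⟨fun b => - ∑ c, D c (shapeSq D N c b) - ∑ c, ∑ e, D c (N e) * D e (D c (N b)),
    fun a => - D a (normSq D N), fun a b => ?_⟩
  have h1 : ∀ c, D c (D c (D a (N b))) = D c (D a (D c (N b))) + N c * D c (shapeSq D N a b)
      + D c (N c) * shapeSq D N a b - D a (N c) * shapeSq D N c b
      - N a * D c (shapeSq D N c b) := by
    intro c
    rw [hS.comm_shape c a b]
    simp only [map_sub, map_add, Derivation.leibniz, smul_eq_mul]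
    rw [hS.shape_symm c a]; ring
  have h2 : ∀ c, D c (D a (D c (N b))) = D a (D c (D c (N b)))
      + N c * ∑ e, D a (N e) * D e (D c (N b)) - N a * ∑ e, D c (N e) * D e (D c (N b)) := by
    intro c
    have h := hS.comm_normal c a (D c (N b))
    simp only [sub_mul, Finset.sum_sub_distrib, mul_assoc, ← Finset.mul_sum] at h
    linear_combination h
  have h3 : ∑ c, N c * D c (shapeSq D N a b) = 0 := by
    have : ∀ c, N c * D c (shapeSq D N a b) =
        ∑ e, (D a (N e) * (N c * D c (D e (N b))) + D e (N b) * (N c * D c (D a (N e)))) := by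
      intro c
      simp only [shapeSq, map_sum, Finset.mul_sum, Derivation.leibniz, smul_eq_mul]
      exact Finset.sum_congr rfl fun e _ => by ring
    simp only [this]
    rw [Finset.sum_comm]
    simp [Finset.sum_add_distrib, ← Finset.mul_sum, hS.sum_normal_deriv_shape]
  have h4 : ∑ c, N c * ∑ e, D a (N e) * D e (D c (N b)) =
      - ∑ e, D a (N e) * shapeSq D N e b := by
    simp only [Finset.mul_sum, mul_left_comm (N _)]
    rw [Finset.sum_comm]
    simp only [← Finset.mul_sum, hS.sum_normal_deriv_deriv]
    simp
  have h5 : ∑ c, D a (D c (D c (N b))) = D a (D b (meanCurvature D N))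
      - D a (N b) * normSq D N - N b * D a (normSq D N) := by
    rw [← map_sum, hS.laplacian_normal, map_sub, Derivation.leibniz]
    simp only [smul_eq_mul]; ring
  simp only [h1, h2, Finset.sum_add_distrib, Finset.sum_sub_distrib, ← Finset.sum_mul,
    ← Finset.mul_sum, h3, h4, h5]
  rw [← meanCurvature]
  ring

/-- The matrix `D c (X a)` is the tangential projection, which fixes a gradient with no normal
component. -/
lemma sum_proj_deriv {F : R} (hF : ∑ c, N c * D c F = 0) (a : ι) :
    ∑ c, D c (X a) * D c F = D a F := by
  simp only [hS.deriv_pos, sub_mul, Finset.sum_sub_distrib, ite_mul, one_mul, zero_mul,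
    Finset.sum_ite_eq', Finset.mem_univ, if_true]
  have : ∑ c, N c * N a * D c F = N a * ∑ c, N c * D c F := by
    rw [Finset.mul_sum]; exact Finset.sum_congr rfl fun c _ => by ring
  rw [this, hF]; ring

lemma laplacian_pos (b : ι) : ∑ c, D c (D c (X b)) = - (meanCurvature D N * N b) := by
  have : ∀ c, D c (D c (X b)) = - (N c * D c (N b)) - D c (N c) * N b := by
    intro c
    simp only [hS.deriv_pos, map_sub, deriv_ite, Derivation.leibniz, smul_eq_mul]
    ring
  simp only [this, Finset.sum_sub_distrib, Finset.sum_neg_distrib, hS.sum_normal_deriv_normal,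
    ← Finset.sum_mul, meanCurvature]
  ring

end IsSurfaceFrame

/-! ### Evolution equations -/

/-- Algebraic model of the evolution `∂X/∂t = f N - κ X` of a hypersurface, where `f H = 1`. -/
structure IsInverseCurvatureFlow {ι R : Type*} [Fintype ι] [DecidableEq ι] [CommRing R]
    [Algebra ℝ R] (D : ι → Derivation ℝ R R) (X N : ι → R) (ρ : R)
    (Dt : Derivation ℝ R R) (f : R) (κ : ℝ) : Prop extends IsSurfaceFrame D X N ρ where
  deriv_time_pos : ∀ b, Dt (X b) = f * N b - κ • X b
  deriv_time_rho : Dt ρ = 0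
  speed : f * IsSurfaceFrame.meanCurvature D N = 1
  comm_time : ∀ a F, Dt (D a F) - D a (Dt F) =
    ∑ c, ((Dt (D a (X c)) - D a (Dt (X c))) + N c * (Dt (D a ρ) - D a (Dt ρ))) * D c F

namespace IsInverseCurvatureFlow

open IsSurfaceFrame

variable {ι R : Type*} [Fintype ι] [DecidableEq ι] [CommRing R] [Algebra ℝ R]
  {D : ι → Derivation ℝ R R} {X N : ι → R} {ρ : R} {Dt : Derivation ℝ R R} {f : R} {κ : ℝ}
  (hF : IsInverseCurvatureFlow D X N ρ Dt f κ)
include hF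

lemma comm_time' (a : ι) (F : R) : Dt (D a F) = D a (Dt F)
    + ∑ c, (κ • ((if a = c then 1 else 0) - N a * N c) - N a * Dt (N c) - D a f * N c
      - f * D a (N c)) * D c F := by
  rw [← sub_eq_iff_eq_add', hF.comm_time]
  refine Finset.sum_congr rfl fun c _ => ?_
  simp only [hF.deriv_pos, hF.deriv_rho, hF.deriv_time_pos, hF.deriv_time_rho, map_sub, deriv_ite,
    Derivation.leibniz, smul_eq_mul, map_zero, Derivation.map_smul]
  ring

/-- Apply the time commutator to `ρ`, which is constant in time and has gradient `N`. The scaling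
term disappears because it multiplies the tangential part of `N`. -/
lemma deriv_time_normal (b : ι) : Dt (N b) = - D b f := by
  have h := hF.comm_time' b ρ
  have h1 : ∑ c, Dt (N c) * N c = 0 := by
    simpa only [mul_comm] using sum_normal_mul_deriv (E := Dt) hF.norm
  have h2 := hF.sum_mul_normal b
  have h3 : ∑ c, (κ • ((if b = c then 1 else 0) - N b * N c) - N b * Dt (N c) - D b f * N c
      - f * D b (N c)) * N c = κ • (N b - N b * ∑ c, N c * N c) - N b * ∑ c, Dt (N c) * N c
        - D b f * ∑ c, N c * N c - f * ∑ c, D b (N c) * N c := by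
    have : N b = ∑ c, (if b = c then (1 : R) else 0) * N c := by simp
    rw [this]
    simp only [Finset.mul_sum, ← Finset.sum_sub_distrib, Finset.smul_sum]
    rw [← this]
    refine Finset.sum_congr rfl fun c _ => ?_
    simp only [Algebra.smul_def]; ring
  simp only [hF.deriv_rho, hF.deriv_time_rho, map_zero] at h
  rw [h3, h1, h2, hF.norm] at h
  rw [h]; simp

/-- The time commutator applied to `N b`. The last term is a multiple of `N a`, hence invisible on
tangent vectors and in the trace. -/
lemma deriv_time_shape (a b : ι) : Dt (D a (N b)) = - D a (D b f) - f * shapeSq D N a b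
    + κ • D a (N b) + N a * ∑ c, D c f * D c (N b) := by
  rw [hF.comm_time' a, hF.deriv_time_normal, map_neg, shapeSq]
  have h3 : ∑ c, (κ • ((if a = c then 1 else 0) - N a * N c) - N a * Dt (N c) - D a f * N c
      - f * D a (N c)) * D c (N b) = κ • (D a (N b) - N a * ∑ c, N c * D c (N b))
        - N a * ∑ c, Dt (N c) * D c (N b)
        - D a f * ∑ c, N c * D c (N b) - f * ∑ c, D a (N c) * D c (N b) := by
    have : D a (N b) = ∑ c, (if a = c then (1 : R) else 0) * D c (N b) := by simp
    rw [this]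
    simp only [Finset.mul_sum, ← Finset.sum_sub_distrib, Finset.smul_sum]
    refine Finset.sum_congr rfl fun c _ => ?_
    simp only [Algebra.smul_def]; ring
  rw [h3, hF.sum_normal_deriv_normal]
  simp only [hF.deriv_time_normal, neg_mul, Finset.sum_neg_distrib]
  simp only [mul_zero, sub_zero]
  ring

lemma deriv_speed (E : Derivation ℝ R R) : E f = - (f * f * E (meanCurvature D N)) := by
  have h := congrArg E hF.speed
  simp only [Derivation.leibniz, smul_eq_mul, Derivation.map_one_eq_zero] at h
  linear_combination f * h - E f * hF.speed

lemma deriv_deriv_speed (a b : ι) : D a (D b f) = - (f * f * D a (D b (meanCurvature D N)))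
    + 2 * (f * f * f) * D a (meanCurvature D N) * D b (meanCurvature D N) := by
  rw [hF.deriv_speed (D b)]
  simp only [map_neg, Derivation.leibniz, smul_eq_mul, hF.deriv_speed (D a)]
  ring

lemma deriv_time_meanCurvature : Dt (meanCurvature D N) =
    - ∑ a, D a (D a f) - f * normSq D N + κ • meanCurvature D N := by
  have h0 : ∑ a, N a * ∑ c, D c f * D c (N a) = 0 := by
    simp only [Finset.mul_sum, mul_left_comm (N _)]
    rw [Finset.sum_comm]
    simp [← Finset.mul_sum, hF.sum_normal_mul]
  rw [hF.normSq_eq, meanCurvature, map_sum]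
  simp only [hF.deriv_time_shape, Finset.sum_add_distrib, Finset.sum_sub_distrib, Finset.sum_neg_distrib, h0,
    ← Finset.mul_sum, ← Finset.smul_sum]
  ring

end IsInverseCurvatureFlow

/-! ### The pinching quantity at a null eigenvector -/

namespace IsSurfaceFrame

variable {ι R : Type*} [Fintype ι] [DecidableEq ι] [CommRing R] [Algebra ℝ R]
  {D : ι → Derivation ℝ R R} {X N : ι → R} {ρ : R}

/-- The second fundamental form evaluated on the (ambient) vector `ξ`. -/
def shapeForm (D : ι → Derivation ℝ R R) (N ξ : ι → R) : R := ∑ a, ∑ b, D a (N b) * ξ a * ξ b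

/-- The squared length of the tangential part of the (ambient) vector `ξ`. -/
def tangentSq (N ξ : ι → R) : R := ∑ b, ξ b * ξ b - (∑ b, N b * ξ b) * ∑ b, N b * ξ b

/-- The pinching quantity `h(ξ, ξ) - η H g(ξ, ξ)`. -/
def pinch (D : ι → Derivation ℝ R R) (N ξ : ι → R) (η : R) : R :=
  shapeForm D N ξ - η * (meanCurvature D N * tangentSq N ξ)

omit [Fintype ι] [DecidableEq ι] in
lemma deriv_deriv_mul (E : Derivation ℝ R R) (u v : R) :
    E (E (u * v)) = E (E u) * v + 2 * (E u * E v) + u * E (E v) := by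
  simp only [Derivation.leibniz, smul_eq_mul, map_add]; ring

variable (hS : IsSurfaceFrame D X N ρ)
include hS

lemma sum_normal_mul_deriv_pos (c : ι) : ∑ b, N b * D c (X b) = 0 := by
  have : ∀ b, N b * D c (X b) = (if c = b then N b else 0) - N c * (N b * N b) := by
    intro b; rw [hS.deriv_pos]; split_ifs <;> ring
  simp only [this, Finset.sum_sub_distrib, ← Finset.mul_sum, hS.norm]
  simp

lemma deriv_pos_symm (a b : ι) : D a (X b) = D b (X a) := by
  rw [hS.deriv_pos, hS.deriv_pos, mul_comm (N a)]
  simp only [eq_comm]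

lemma sum_normal_deriv_pos (b : ι) : ∑ c, N c * D c (X b) = 0 := by
  simp_rw [fun c => hS.deriv_pos_symm c b]
  exact hS.sum_normal_mul_deriv_pos b

variable {ξ : ι → R} {k : ℝ} (hξ : ∀ a b, D a (ξ b) = k • D a (X b))
include hξ

/-- The assumption on `ξ` is met by a constant vector plus `k • X`. The mixed terms, linear in `k`,
reduce by the traced Codazzi equation to derivatives of `H`; the `k²` term is the trace of the shape
operator. Second derivatives of `ξ` are normal and drop out. -/
lemma laplacian_shapeForm : ∑ c, D c (D c (shapeForm D N ξ)) =
    (∑ a, ∑ b, (∑ c, D c (D c (D a (N b)))) * ξ a * ξ b)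
      + (4 * k) • (∑ b, D b (meanCurvature D N) * ξ b - normSq D N * ∑ b, N b * ξ b)
      + (2 * k ^ 2) • meanCurvature D N := by
  have hexp : ∀ c a b, D c (D c (D a (N b) * ξ a * ξ b)) =
      D c (D c (D a (N b))) * ξ a * ξ b + (2 * k) • (D c (X a) * D c (D a (N b)) * ξ b)
      + (2 * k) • (D c (X b) * D c (D b (N a)) * ξ a)
      + (2 * k ^ 2) • (D a (N b) * (D c (X a) * D c (X b)))
      + k • (D a (N b) * D c (D c (X a)) * ξ b) + k • (D b (N a) * D c (D c (X b)) * ξ a) := by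
    intro c a b
    rw [hS.shape_symm b a]
    simp only [Derivation.leibniz, smul_eq_mul, map_add, hξ, Algebra.smul_def, map_mul,
      map_ofNat, map_pow]
    simp only [Derivation.map_algebraMap]
    ring
  have hT2 : ∑ c, ∑ a, ∑ b, D c (X a) * D c (D a (N b)) * ξ b =
      ∑ b, D b (meanCurvature D N) * ξ b - normSq D N * ∑ b, N b * ξ b := by
    rw [Finset.sum_comm]
    have : ∀ a, ∑ c, ∑ b, D c (X a) * D c (D a (N b)) * ξ b = ∑ b, D a (D a (N b)) * ξ b := by
      intro a
      rw [Finset.sum_comm]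
      refine Finset.sum_congr rfl fun b _ => ?_
      rw [← Finset.sum_mul, hS.sum_proj_deriv (hS.sum_normal_deriv_shape a b)]
    simp only [this]
    rw [Finset.sum_comm]
    simp only [← Finset.sum_mul, hS.laplacian_normal, sub_mul, Finset.sum_sub_distrib,
      Finset.mul_sum]
    congr 1
    exact Finset.sum_congr rfl fun b _ => by ring
  have hT2' : ∑ c, ∑ a, ∑ b, D c (X b) * D c (D b (N a)) * ξ a =
      ∑ b, D b (meanCurvature D N) * ξ b - normSq D N * ∑ b, N b * ξ b := by
    rw [← hT2]
    exact Finset.sum_congr rfl fun c _ => Finset.sum_comm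
  have hT3 : ∑ c, ∑ a, ∑ b, D a (N b) * (D c (X a) * D c (X b)) = meanCurvature D N := by
    rw [Finset.sum_comm]
    rw [meanCurvature]
    refine Finset.sum_congr rfl fun a _ => ?_
    rw [Finset.sum_comm]
    simp only [← Finset.mul_sum, hS.sum_proj_deriv (hS.sum_normal_deriv_pos _)]
    have : ∀ b, D a (N b) * D a (X b) =
        (if a = b then D a (N b) else 0) - N a * (N b * D a (N b)) := by
      intro b; rw [hS.deriv_pos]; split_ifs <;> ring
    simp only [this, Finset.sum_sub_distrib, ← Finset.mul_sum, hS.sum_normal_mul]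
    simp
  have hT4 : ∑ c, ∑ a, ∑ b, D a (N b) * D c (D c (X a)) * ξ b = 0 := by
    have : ∀ a, ∑ c, ∑ b, D a (N b) * D c (D c (X a)) * ξ b =
        - (meanCurvature D N * ∑ b, N a * D a (N b) * ξ b) := by
      intro a
      rw [Finset.sum_comm, Finset.mul_sum, ← Finset.sum_neg_distrib]
      refine Finset.sum_congr rfl fun b _ => ?_
      rw [← Finset.sum_mul, ← Finset.mul_sum, hS.laplacian_pos]; ring
    rw [Finset.sum_comm]
    simp only [this, Finset.sum_neg_distrib, ← Finset.mul_sum]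
    rw [Finset.sum_comm]
    simp [← Finset.sum_mul, hS.sum_normal_deriv_normal]
  have hT4' : ∑ c, ∑ a, ∑ b, D b (N a) * D c (D c (X b)) * ξ a = 0 := by
    rw [← hT4]
    exact Finset.sum_congr rfl fun c _ => Finset.sum_comm
  have hT1 : ∑ c, ∑ a, ∑ b, D c (D c (D a (N b))) * ξ a * ξ b =
      ∑ a, ∑ b, (∑ c, D c (D c (D a (N b)))) * ξ a * ξ b := by
    rw [Finset.sum_comm]
    refine Finset.sum_congr rfl fun a _ => ?_
    rw [Finset.sum_comm]
    simp only [Finset.sum_mul]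
  simp only [shapeForm, map_sum, hexp, Finset.sum_add_distrib, ← Finset.smul_sum, hT1, hT2, hT2',
    hT3, hT4, hT4']
  simp only [Algebra.smul_def, map_mul, map_ofNat, map_pow]
  ring

lemma deriv_inner_normal (c : ι) : D c (∑ b, N b * ξ b) = ∑ b, D c (N b) * ξ b := by
  have : ∀ b, D c (N b * ξ b) = D c (N b) * ξ b + k • (N b * D c (X b)) := by
    intro b
    simp only [Derivation.leibniz, smul_eq_mul, hξ, Algebra.smul_def]; ring
  simp only [map_sum, this, Finset.sum_add_distrib, ← Finset.smul_sum,
    hS.sum_normal_mul_deriv_pos]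
  simp

lemma deriv_tangentSq (c : ι) : D c (tangentSq N ξ) =
    (2 * k) • ∑ b, D c (X b) * ξ b - 2 * (∑ b, N b * ξ b) * ∑ b, D c (N b) * ξ b := by
  have : ∀ b, D c (ξ b * ξ b) = (2 * k) • (D c (X b) * ξ b) := by
    intro b
    simp only [Derivation.leibniz, smul_eq_mul, hξ, Algebra.smul_def, map_mul, map_ofNat]; ring
  rw [tangentSq, map_sub, Derivation.leibniz, map_sum]
  simp only [this, ← Finset.smul_sum, hS.deriv_inner_normal hξ, smul_eq_mul]
  ring

lemma sum_deriv_mul_deriv_tangentSq {F : R} (hF : ∑ c, N c * D c F = 0) :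
    ∑ c, D c F * D c (tangentSq N ξ) = (2 * k) • ∑ b, D b F * ξ b
      - 2 * (∑ b, N b * ξ b) * ∑ c, D c F * ∑ b, D c (N b) * ξ b := by
  have h1 : ∑ c, D c F * ∑ b, D c (X b) * ξ b = ∑ b, D b F * ξ b := by
    simp only [Finset.mul_sum]
    rw [Finset.sum_comm]
    refine Finset.sum_congr rfl fun b _ => ?_
    rw [← hS.sum_proj_deriv hF b, Finset.sum_mul]
    exact Finset.sum_congr rfl fun c _ => by ring
  simp only [hS.deriv_tangentSq hξ, mul_sub, Finset.sum_sub_distrib, mul_smul_comm,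
    ← Finset.smul_sum, h1, mul_left_comm (D _ F), ← Finset.mul_sum]

/-- The factor `card ι - 1` is the squared norm of the tangential projection, the dimension of the
surface. The Laplacian of the normal component of `ξ` stays unexpanded: its coefficient vanishes
where `ξ` is tangent. -/
lemma laplacian_tangentSq : ∑ c, D c (D c (tangentSq N ξ)) =
    (2 * k ^ 2) • ((Fintype.card ι : R) - 1)
      - (2 * k) • (meanCurvature D N * ∑ b, N b * ξ b)
      - 2 * ∑ c, (∑ b, D c (N b) * ξ b) * (∑ b, D c (N b) * ξ b)
      - 2 * (∑ b, N b * ξ b) * ∑ c, D c (D c (∑ b, N b * ξ b)) := by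
  have h1 : ∀ c b, D c (D c (ξ b * ξ b)) =
      (2 * k) • (D c (D c (X b)) * ξ b) + (2 * k ^ 2) • (D c (X b) * D c (X b)) := by
    intro c b
    rw [deriv_deriv_mul, hξ, Derivation.map_smul]
    simp only [Algebra.smul_def, map_mul, map_ofNat, map_pow]; ring
  have h2 : ∑ c, ∑ b, D c (X b) * D c (X b) = (Fintype.card ι : R) - 1 := by
    rw [Finset.sum_comm]
    simp only [hS.sum_proj_deriv (hS.sum_normal_deriv_pos _)]
    simp [hS.deriv_pos, Finset.sum_sub_distrib, hS.norm]
  have h3 : ∑ c, ∑ b, D c (D c (X b)) * ξ b = - (meanCurvature D N * ∑ b, N b * ξ b) := by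
    rw [Finset.sum_comm, Finset.mul_sum, ← Finset.sum_neg_distrib]
    refine Finset.sum_congr rfl fun b _ => ?_
    rw [← Finset.sum_mul, hS.laplacian_pos]; ring
  have h4 : ∀ c, D c (D c (tangentSq N ξ)) = ∑ b, D c (D c (ξ b * ξ b))
      - 2 * ((∑ b, D c (N b) * ξ b) * ∑ b, D c (N b) * ξ b)
      - 2 * (∑ b, N b * ξ b) * D c (D c (∑ b, N b * ξ b)) := by
    intro c
    rw [tangentSq, map_sub, map_sub, deriv_deriv_mul, map_sum, map_sum,
      hS.deriv_inner_normal hξ c]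
    ring
  simp only [h4, h1, Finset.sum_sub_distrib, Finset.sum_add_distrib, ← Finset.smul_sum, h2, h3,
    ← Finset.mul_sum]
  simp only [Algebra.smul_def, map_mul, map_ofNat, map_pow]; ring

/-- The Laplacian of the pinching quantity at a null eigenvector. -/
lemma eval_laplacian_pinch {η : R} (hη : ∀ a, D a η = 0) (e : R →ₐ[ℝ] ℝ)
    (h0 : ∑ b, e (N b) * e (ξ b) = 0) (h1 : ∑ b, e (ξ b) * e (ξ b) = 1)
    (hev : ∀ b, ∑ a, e (D a (N b)) * e (ξ a) = e η * e (meanCurvature D N) * e (ξ b)) :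
    e (∑ c, D c (D c (pinch D N ξ η))) =
      (∑ a, ∑ b, e (D a (D b (meanCurvature D N))) * e (ξ a) * e (ξ b))
      - e (normSq D N) * (e η * e (meanCurvature D N))
      + e (meanCurvature D N) * (e η * e (meanCurvature D N)) ^ 2
      - 2 * (e η * e (meanCurvature D N)) ^ 3
      + 4 * k * (∑ b, e (D b (meanCurvature D N)) * e (ξ b))
      + 2 * k ^ 2 * e (meanCurvature D N)
      - e η * ((∑ c, e (D c (D c (meanCurvature D N))))
        + 4 * k * (∑ b, e (D b (meanCurvature D N)) * e (ξ b))
        + e (meanCurvature D N) * (2 * k ^ 2 * ((Fintype.card ι : ℝ) - 1)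
          - 2 * (e η * e (meanCurvature D N)) ^ 2)) := by
  set H := meanCurvature D N with hH
  set μ : ℝ := e η * e H with hμ
  have hev' : ∀ a, ∑ b, e (D a (N b)) * e (ξ b) = μ * e (ξ a) := by
    intro a; rw [← hev a]; simp_rw [fun b => hS.shape_symm a b]
  have hsq : ∀ a, ∑ b, e (shapeSq D N a b) * e (ξ b) = μ ^ 2 * e (ξ a) := by
    intro a
    simp only [shapeSq, map_sum, map_mul, Finset.sum_mul]
    rw [Finset.sum_comm]
    simp only [mul_assoc, ← Finset.mul_sum, hev']
    simp only [mul_left_comm _ μ, ← Finset.mul_sum, hev']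
    ring
  obtain ⟨M, hM⟩ : ∃ M : ι → ι → ℝ, ∀ a b, e (∑ c, D a (N c) * shapeSq D N c b) = M a b :=
    ⟨_, fun _ _ => rfl⟩
  have hcube : ∀ a, ∑ b, M a b * e (ξ b) = μ ^ 3 * e (ξ a) := by
    intro a
    simp only [← hM, map_sum, map_mul, Finset.sum_mul]
    rw [Finset.sum_comm]
    simp only [mul_assoc, ← Finset.mul_sum, hsq]
    simp only [mul_left_comm _ (μ ^ 2), ← Finset.mul_sum, hev']
    ring
  obtain ⟨U, V, hUV⟩ := hS.simons
  have hquad : ∀ M : ι → ι → ℝ, ∀ r : ℝ, (∀ a, ∑ b, M a b * e (ξ b) = r * e (ξ a)) →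
      ∑ a, ∑ b, M a b * e (ξ a) * e (ξ b) = r := by
    intro M r hM
    have : ∀ a, ∑ b, M a b * e (ξ a) * e (ξ b) = r * (e (ξ a) * e (ξ a)) := by
      intro a
      rw [← mul_assoc, ← hM a, Finset.sum_mul]
      exact Finset.sum_congr rfl fun b _ => by ring
    simp only [this, ← Finset.mul_sum, h1, mul_one]
  have hshape : e (∑ c, D c (D c (shapeForm D N ξ))) =
      (∑ a, ∑ b, e (D a (D b H)) * e (ξ a) * e (ξ b)) - e (normSq D N) * μ + e H * μ ^ 2
        - 2 * μ ^ 3 + 4 * k * (∑ b, e (D b H) * e (ξ b)) + 2 * k ^ 2 * e H := by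
    rw [hS.laplacian_shapeForm hξ]
    have hs : ∀ a b, e ((∑ c, D c (D c (D a (N b)))) * ξ a * ξ b) =
        e (D a (D b H)) * e (ξ a) * e (ξ b)
        - e (normSq D N) * (e (D a (N b)) * e (ξ a) * e (ξ b))
        + e H * (e (shapeSq D N a b) * e (ξ a) * e (ξ b))
        - 2 * (M a b * e (ξ a) * e (ξ b))
        + (e (N a) * e (ξ a)) * (e (U b) * e (ξ b))
        + (e (V a) * e (ξ a)) * (e (N b) * e (ξ b)) := by
      intro a b
      rw [hUV, ← hM]
      simp only [map_add, map_sub, map_mul, map_ofNat, hH]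
      ring
    simp only [map_add, map_sub, map_smul, map_sum, hs, map_mul, h0, smul_eq_mul,
      Finset.sum_add_distrib, Finset.sum_sub_distrib, ← Finset.mul_sum, ← Finset.sum_mul]
    rw [hquad _ _ hev', hquad _ _ hsq, hquad _ _ hcube]
    simp only [hH]
    ring
  have htan : e (tangentSq N ξ) = 1 := by
    simp [tangentSq, map_sub, map_mul, map_sum, h0, h1]
  have hlap : e (∑ c, D c (D c (tangentSq N ξ))) =
      2 * k ^ 2 * ((Fintype.card ι : ℝ) - 1) - 2 * μ ^ 2 := by
    rw [hS.laplacian_tangentSq hξ]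
    have : ∑ c, (μ * e (ξ c)) * (μ * e (ξ c)) = μ ^ 2 := by
      rw [← mul_one (μ ^ 2), ← h1, Finset.mul_sum]
      exact Finset.sum_congr rfl fun b _ => by ring
    simp only [map_sub, map_smul, map_mul, map_sum, h0, hev', this, smul_eq_mul, map_ofNat,
      map_natCast, map_one]
    ring
  have hgrad : e (∑ c, D c H * D c (tangentSq N ξ)) = 2 * k * ∑ b, e (D b H) * e (ξ b) := by
    rw [hS.sum_deriv_mul_deriv_tangentSq hξ hS.sum_normal_deriv_meanCurvature]
    simp only [map_sub, map_smul, map_mul, map_sum, h0, smul_eq_mul, map_ofNat, hH]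
    ring
  have hG : ∑ c, D c (D c (pinch D N ξ η)) = ∑ c, D c (D c (shapeForm D N ξ))
      - η * (tangentSq N ξ * ∑ c, D c (D c H) + 2 * ∑ c, D c H * D c (tangentSq N ξ)
        + H * ∑ c, D c (D c (tangentSq N ξ))) := by
    have : ∀ c, D c (D c (pinch D N ξ η)) = D c (D c (shapeForm D N ξ))
      - η * (tangentSq N ξ * D c (D c H) + 2 * (D c H * D c (tangentSq N ξ))
        + H * D c (D c (tangentSq N ξ))) := by
      intro c
      rw [pinch, map_sub, map_sub, deriv_deriv_mul, deriv_deriv_mul, hη c, map_zero]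
      ring
    simp only [this, Finset.sum_sub_distrib, Finset.sum_add_distrib, ← Finset.mul_sum]
  rw [hG, map_sub, map_mul, map_add, map_add, map_mul, map_mul, map_mul, hshape, htan, hgrad, hlap,
    map_sum, map_ofNat]
  ring

omit hξ in
/-- The Cauchy–Schwarz inequality `H² ≤ n |A|²`. -/
lemma eval_meanCurvature_sq_le (e : R →ₐ[ℝ] ℝ) :
    e (meanCurvature D N) ^ 2 ≤ ((Fintype.card ι : ℝ) - 1) * e (normSq D N) := by
  -- `H` is written as the inner product of the shape operator with the tangential projection, not
  -- with the identity, so that the constant is the dimension of the surface and not that of the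
  -- ambient space.
  have h1 : ∑ a, ∑ b, D a (N b) * D a (X b) = meanCurvature D N := by
    rw [meanCurvature]
    refine Finset.sum_congr rfl fun a _ => ?_
    have : ∀ b, D a (N b) * D a (X b) =
        (if a = b then D a (N b) else 0) - N a * (N b * D a (N b)) := by
      intro b; rw [hS.deriv_pos]; split_ifs <;> ring
    simp only [this, Finset.sum_sub_distrib, ← Finset.mul_sum, hS.sum_normal_mul]
    simp
  have h2 : ∑ c, ∑ b, D c (X b) * D c (X b) = (Fintype.card ι : R) - 1 := by
    rw [Finset.sum_comm]
    simp only [hS.sum_proj_deriv (hS.sum_normal_deriv_pos _)]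
    simp [hS.deriv_pos, Finset.sum_sub_distrib, hS.norm]
  have h := Finset.sum_mul_sq_le_sq_mul_sq (Finset.univ : Finset (ι × ι))
    (fun p => e (D p.1 (N p.2))) (fun p => e (D p.1 (X p.2)))
  simp only [Fintype.sum_prod_type, pow_two (e (D _ _)), ← map_mul, ← map_sum, h1, h2] at h
  rw [normSq, mul_comm]
  simpa using h

end IsSurfaceFrame

namespace IsInverseCurvatureFlow

open IsSurfaceFrame

variable {ι R : Type*} [Fintype ι] [DecidableEq ι] [CommRing R] [Algebra ℝ R]
  {D : ι → Derivation ℝ R R} {X N : ι → R} {ρ : R} {Dt : Derivation ℝ R R} {f : R} {κ : ℝ}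

/-- The time derivative of the pinching quantity at a null eigenvector. -/
lemma eval_deriv_time_pinch (hF : IsInverseCurvatureFlow D X N ρ Dt f κ) {ξ : ι → R} {η : R}
    (e : R →ₐ[ℝ] ℝ)
    (h0 : ∑ b, e (N b) * e (ξ b) = 0) (h1 : ∑ b, e (ξ b) * e (ξ b) = 1)
    (hev : ∀ b, ∑ a, e (D a (N b)) * e (ξ a) = e η * e (meanCurvature D N) * e (ξ b)) :
    e (Dt (pinch D N ξ η)) =
      (e f) ^ 2 * (∑ a, ∑ b, e (D a (D b (meanCurvature D N))) * e (ξ a) * e (ξ b))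
      - 2 * (e f) ^ 3 * (∑ b, e (D b (meanCurvature D N)) * e (ξ b)) ^ 2
      - e f * (e η * e (meanCurvature D N)) ^ 2
      - e (Dt η) * e (meanCurvature D N)
      - e η * ((e f) ^ 2 * (∑ c, e (D c (D c (meanCurvature D N))))
        - 2 * (e f) ^ 3 * (∑ c, e (D c (meanCurvature D N)) ^ 2) - e f * e (normSq D N)) := by
  set H := meanCurvature D N with hH
  set μ : ℝ := e η * e H with hμ
  have hev' : ∀ a, ∑ b, e (D a (N b)) * e (ξ b) = μ * e (ξ a) := by
    intro a; rw [← hev a]; simp_rw [fun b => hF.shape_symm a b]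
  have hsq : ∀ a, ∑ b, e (shapeSq D N a b) * e (ξ b) = μ ^ 2 * e (ξ a) := by
    intro a
    simp only [shapeSq, map_sum, map_mul, Finset.sum_mul]
    rw [Finset.sum_comm]
    simp only [mul_assoc, ← Finset.mul_sum, hev']
    simp only [mul_left_comm _ μ, ← Finset.mul_sum, hev']
    ring
  have hquad : ∀ M : ι → ι → ℝ, ∀ r : ℝ, (∀ a, ∑ b, M a b * e (ξ b) = r * e (ξ a)) →
      ∑ a, ∑ b, M a b * e (ξ a) * e (ξ b) = r := by
    intro M r hM
    have : ∀ a, ∑ b, M a b * e (ξ a) * e (ξ b) = r * (e (ξ a) * e (ξ a)) := by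
      intro a
      rw [← mul_assoc, ← hM a, Finset.sum_mul]
      exact Finset.sum_congr rfl fun b _ => by ring
    simp only [this, ← Finset.mul_sum, h1, mul_one]
  -- Nothing is assumed about the time derivative of `ξ`: at an eigenvector with eigenvalue `μ = ηH`
  -- it contributes `2μz` both to `h(ξ, ξ)` and to `ηH g(ξ, ξ)`, which cancels. The `κ` terms cancel
  -- in the same way.
  set y : ι → ℝ := fun b => e (Dt (ξ b)) with hy
  set z : ℝ := ∑ b, e (ξ b) * y b with hz
  have hshape : e (Dt (shapeForm D N ξ)) =
      - (∑ a, ∑ b, e (D a (D b f)) * e (ξ a) * e (ξ b)) - e f * μ ^ 2 + κ * μ + 2 * μ * z := by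
    have hs : ∀ a b, e (Dt (D a (N b) * ξ a * ξ b)) =
        - (e (D a (D b f)) * e (ξ a) * e (ξ b)) - e f * (e (shapeSq D N a b) * e (ξ a) * e (ξ b))
        + κ * (e (D a (N b)) * e (ξ a) * e (ξ b))
        + (e (N a) * e (ξ a)) * (e (∑ c, D c f * D c (N b)) * e (ξ b))
        + y a * (e (D a (N b)) * e (ξ b)) + y b * (e (D b (N a)) * e (ξ a)) := by
      intro a b
      simp only [Derivation.leibniz, smul_eq_mul, hF.deriv_time_shape, map_add, map_sub, map_mul,
        map_neg, map_smul, hy, hF.shape_symm b a]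
      ring
    have hcross : ∑ a, ∑ b, y b * (e (D b (N a)) * e (ξ a)) =
        ∑ a, ∑ b, y a * (e (D a (N b)) * e (ξ b)) := Finset.sum_comm
    have hcross' : ∑ a, y a * ∑ b, e (D a (N b)) * e (ξ b) = μ * z := by
      simp only [hev', hz]
      rw [Finset.mul_sum]
      exact Finset.sum_congr rfl fun b _ => by ring
    simp only [shapeForm, map_sum, hs, Finset.sum_add_distrib, Finset.sum_sub_distrib,
      Finset.sum_neg_distrib, hcross, hcross', ← Finset.mul_sum, ← Finset.sum_mul, h0]
    rw [hquad _ _ hev', hquad _ _ hsq]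
    ring
  have htan : e (tangentSq N ξ) = 1 := by
    simp [tangentSq, map_sub, map_mul, map_sum, h0, h1]
  have hdtan : e (Dt (tangentSq N ξ)) = 2 * z := by
    rw [tangentSq, map_sub, Derivation.leibniz, map_sum]
    simp only [Derivation.leibniz, smul_eq_mul, map_sub, map_add, map_sum, map_mul, h0, hz,
      Finset.sum_add_distrib, hy]
    ring
  have hhess : (∑ a, ∑ b, e (D a (D b f)) * e (ξ a) * e (ξ b)) =
      - ((e f) ^ 2 * ∑ a, ∑ b, e (D a (D b H)) * e (ξ a) * e (ξ b))
      + 2 * (e f) ^ 3 * (∑ b, e (D b H) * e (ξ b)) ^ 2 := by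
    have : ∀ a b, e (D a (D b f)) * e (ξ a) * e (ξ b) =
        - ((e f) ^ 2 * (e (D a (D b H)) * e (ξ a) * e (ξ b)))
        + 2 * (e f) ^ 3 * ((e (D a H) * e (ξ a)) * (e (D b H) * e (ξ b))) := by
      intro a b
      rw [hF.deriv_deriv_speed]
      simp only [map_add, map_neg, map_mul, map_ofNat, hH]; ring
    simp only [this, Finset.sum_add_distrib, Finset.sum_neg_distrib, ← Finset.mul_sum,
      ← Finset.sum_mul]
    ring
  have hlap : e (∑ a, D a (D a f)) = - ((e f) ^ 2 * ∑ c, e (D c (D c H)))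
      + 2 * (e f) ^ 3 * ∑ c, e (D c H) ^ 2 := by
    have : ∀ a, e (D a (D a f)) = - ((e f) ^ 2 * e (D a (D a H)))
        + 2 * (e f) ^ 3 * e (D a H) ^ 2 := by
      intro a
      rw [hF.deriv_deriv_speed]
      simp only [map_add, map_neg, map_mul, map_ofNat, hH]; ring
    simp only [map_sum, this, Finset.sum_add_distrib, Finset.sum_neg_distrib, ← Finset.mul_sum]
  rw [pinch, map_sub, Derivation.leibniz, Derivation.leibniz, ← hH]
  simp only [smul_eq_mul, map_sub, map_add, map_mul, hshape, htan, hdtan, hhess]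
  rw [hH, hF.deriv_time_meanCurvature, ← hH]
  simp only [map_add, map_sub, map_neg, map_mul, map_smul, hlap, smul_eq_mul]
  simp only [hμ]
  ring

end IsInverseCurvatureFlow

/-! ### The algebraic inequality at a first contact -/

/-- The scalar inequality that rules out a first contact. -/
lemma contact_impossible {n h η d C a s g q l f k : ℝ} (hn : 1 ≤ n) (hh : 0 < h) (hf : f * h = 1)
    (hη : n * η < 1) (hd : 0 < d) (hd1 : d ≤ 1) (hηd : -d ≤ η) (hgs : g ^ 2 ≤ s)
    (ha : h ^ 2 ≤ n * a) (hC : 2 * (a * h ^ 2 + h ^ 4) + 2 * (n + 1) * s < C * h ^ 4)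
    (hk : k = -((1 - η) * g / ((1 - n * η) * h)))
    (hL : 0 ≤ q - a * (η * h) + h * (η * h) ^ 2 - 2 * (η * h) ^ 3 + 4 * k * g + 2 * k ^ 2 * h
      - η * (l + 4 * k * g + h * (2 * k ^ 2 * n - 2 * (η * h) ^ 2)))
    (ht : f ^ 2 * q - 2 * f ^ 3 * g ^ 2 - f * (η * h) ^ 2 - (-(C * d)) * h
      - η * (f ^ 2 * l - 2 * f ^ 3 * s - f * a) ≤ 0) : False := by
  obtain rfl : f = 1 / h := eq_one_div_of_mul_eq_one_left hf
  have hm : 0 < 1 - n * η := by linarith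
  set r := (1 - η) ^ 2 / (1 - n * η) with hr
  have ht' : h * q - 2 * g ^ 2 - h ^ 4 * η ^ 2 + C * d * h ^ 4
      - η * (h * l - 2 * s - h ^ 2 * a) ≤ 0 := by
    have := mul_nonpos_of_nonneg_of_nonpos (pow_pos hh 3).le ht
    refine le_of_eq_of_le ?_ this
    field_simp
    ring
  -- `h` times `hL`. As a function of `k h` it contains `2(1-nη)(kh)² + 4(1-η)g(kh)`; the prescribed
  -- `k` is the minimizer, with minimum `-2 r g²`.
  have hL' : 0 ≤ h * q - a * η * h ^ 2 + η ^ 2 * h ^ 4 - η * h * l - 2 * r * g ^ 2 := by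
    have := mul_nonneg hh.le hL
    have hm' := hm.ne'
    obtain ⟨w, hw⟩ : ∃ w, w = (1 - η) / (1 - n * η) := ⟨_, rfl⟩
    have hw1 : w * (1 - n * η) = 1 - η := by rw [hw]; exact div_mul_cancel₀ _ hm'
    have hr' : r = w * (1 - η) := by rw [hr, hw]; ring
    have hk' : k * h = - (w * g) := by
      rw [hk, hw, ← div_div]; field_simp
    refine le_of_le_of_eq this ?_
    linear_combination (4 * g * (1 - η) + 2 * (1 - n * η) * (k * h - w * g)) * hk'
      + 2 * g ^ 2 * w * hw1 + 2 * g ^ 2 * hr'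
  -- Subtracting the two inequalities eliminates the second derivatives `q` and `l` of the mean
  -- curvature.
  have key : C * d * h ^ 4 + 2 * η * (a * h ^ 2 - η * h ^ 4) - 2 * g ^ 2 + 2 * η * s
      + 2 * r * g ^ 2 ≤ 0 := by linarith
  have hs : 0 ≤ s := le_trans (sq_nonneg g) hgs
  have ha0 : 0 ≤ a := by
    by_contra! hneg
    nlinarith [sq_nonneg h]
  have hCp : 0 < C * d * h ^ 4 := by
    have : 0 < C * h ^ 4 := lt_of_le_of_lt (by positivity) hC
    rw [mul_right_comm]
    exact mul_pos this hd
  rcases le_or_gt 0 η with h0 | h0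
  -- For `η ≥ 0`, `r ≥ 1 - η` and `s ≥ g²` make the gradient terms nonnegative, and so is the
  -- reaction term; the term with `C` is strictly positive.
  · have h1 : 1 - η ≤ r := by
      rw [hr, le_div_iff₀ hm]
      have : 0 ≤ 1 - η := by nlinarith
      nlinarith [mul_nonneg this (mul_nonneg (sub_nonneg.2 hn) h0)]
    have h2 : 0 ≤ a - η * h ^ 2 := by
      have h3 : n * (η * h ^ 2) ≤ n * a := by nlinarith [sq_nonneg h]
      have := le_of_mul_le_mul_left h3 (by linarith)
      linarith
    have h3 : 0 ≤ η * (a * h ^ 2 - η * h ^ 4) := by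
      have : η * (a * h ^ 2 - η * h ^ 4) = η * ((a - η * h ^ 2) * h ^ 2) := by ring
      rw [this]; positivity
    nlinarith [mul_le_mul_of_nonneg_right h1 (sq_nonneg g), mul_nonneg h0 (sub_nonneg.2 hgs)]
  -- For `η < 0`, `|η| ≤ d ≤ 1` makes every negative term of order `d`. Together they are at least
  -- `-d (2(a h² + h⁴) + 2(n+1)s)`, which is the origin of the condition on `C`.
  · have h1 : 1 - n * d ≤ r := by
      rw [hr, le_div_iff₀ hm]
      have h2 : n * -η ≤ n * d := mul_le_mul_of_nonneg_left (by linarith) (by linarith)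
      calc (1 - n * d) * (1 - n * η) ≤ (1 + n * η) * (1 - n * η) :=
            mul_le_mul_of_nonneg_right (by linarith) hm.le
        _ = 1 - (n * η) ^ 2 := by ring
        _ ≤ 1 := by linarith [sq_nonneg (n * η)]
        _ ≤ (1 - η) ^ 2 := one_le_pow₀ (by linarith)
    have h2 : η ^ 2 ≤ d := calc
      η ^ 2 = (-η) ^ 2 := (neg_sq η).symm
      _ ≤ d ^ 2 := pow_le_pow_left₀ (by linarith) (by linarith) 2
      _ ≤ d := by rw [sq]; exact mul_le_of_le_one_left hd.le hd1
    have h3 : - (d * (a * h ^ 2)) ≤ η * (a * h ^ 2) := by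
      rw [← neg_mul]
      exact mul_le_mul_of_nonneg_right hηd (by positivity)
    have h4 : η ^ 2 * h ^ 4 ≤ d * h ^ 4 := mul_le_mul_of_nonneg_right h2 (by positivity)
    have h5 : - (d * s) ≤ η * s := by
      rw [← neg_mul]
      exact mul_le_mul_of_nonneg_right hηd hs
    have h6 : (1 - n * d) * g ^ 2 ≤ r * g ^ 2 := mul_le_mul_of_nonneg_right h1 (sq_nonneg g)
    have h7 : n * d * g ^ 2 ≤ n * d * s := mul_le_mul_of_nonneg_left hgs (by positivity)
    have h8 := mul_lt_mul_of_pos_left hC hd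
    linarith

/-! ### The ring of smooth functions on a set and its derivations -/

section SmoothFunctions

variable {E : Type*} [NormedAddCommGroup E] [NormedSpace ℝ E] {S : Set E}

/-- The algebra of real functions on `S` that are restrictions of functions smooth on `S`. -/
def smoothOn (S : Set E) : Subalgebra ℝ (S → ℝ) where
  carrier := {F | ∃ G : E → ℝ, ContDiffOn ℝ ∞ G S ∧ ∀ p : S, F p = G p}
  mul_mem' := by
    rintro F F' ⟨G, hG, h⟩ ⟨G', hG', h'⟩
    exact ⟨fun x => G x * G' x, hG.mul hG', fun p => by simp [h, h']⟩
  add_mem' := by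
    rintro F F' ⟨G, hG, h⟩ ⟨G', hG', h'⟩
    exact ⟨fun x => G x + G' x, hG.add hG', fun p => by simp [h, h']⟩
  algebraMap_mem' r := ⟨fun _ => r, contDiffOn_const, fun _ => rfl⟩

namespace smoothOn

/-- The element of `smoothOn S` given by a function smooth on `S`. -/
def mk (G : E → ℝ) (hG : ContDiffOn ℝ ∞ G S) : smoothOn S := ⟨fun p => G p, G, hG, fun _ => rfl⟩

/-- The extension by zero of a function on `S`. -/
noncomputable def ext (F : smoothOn S) : E → ℝ := Function.extend Subtype.val F.1 0

lemma ext_apply (F : smoothOn S) (p : S) : ext F p = F.1 p :=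
  Subtype.val_injective.extend_apply _ _ _

@[simp] lemma mk_apply (G : E → ℝ) (hG : ContDiffOn ℝ ∞ G S) (p : S) : (mk G hG).1 p = G p := rfl

lemma contDiffOn_ext (F : smoothOn S) : ContDiffOn ℝ ∞ (ext F) S := by
  obtain ⟨G, hG, h⟩ := F.2
  exact hG.congr fun x hx => by rw [ext_apply F ⟨x, hx⟩, h]

lemma ext_mk (G : E → ℝ) (hG : ContDiffOn ℝ ∞ G S) : EqOn (ext (mk G hG)) G S :=
  fun x hx => ext_apply (mk G hG) ⟨x, hx⟩

/-- Evaluation at a point of `S`. -/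
def eval (p : S) : smoothOn S →ₐ[ℝ] ℝ := (Pi.evalAlgHom ℝ (fun _ : S => ℝ) p).comp (smoothOn S).val

@[simp] lemma eval_apply (p : S) (F : smoothOn S) : eval p F = F.1 p := rfl

lemma ext_ext {F G : smoothOn S} (h : ∀ p, eval p F = eval p G) : F = G :=
  Subtype.ext (funext h)

/-- The directional derivative along a smooth vector field, as a derivation of `smoothOn S`. -/
noncomputable def dirDeriv (hS : UniqueDiffOn ℝ S) (v : E → E) (hv : ContDiffOn ℝ ∞ v S) :
    Derivation ℝ (smoothOn S) (smoothOn S) :=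
  Derivation.mk'
    { toFun := fun F => mk (fun p => fderivWithin ℝ (ext F) S p (v p))
        (((contDiffOn_ext F).fderivWithin hS le_rfl).clm_apply hv)
      map_add' := fun F G => by
        refine ext_ext fun p => ?_
        have h : EqOn (ext (F + G)) (fun x => ext F x + ext G x) S := fun x hx => by
          simp [ext_apply _ (⟨x, hx⟩ : S)]
        simp only [map_add, eval_apply, mk_apply]
        rw [fderivWithin_congr h (h p.2), fderivWithin_fun_add (hS p p.2)
          (((contDiffOn_ext F).differentiableOn (by simp)) p p.2)
          (((contDiffOn_ext G).differentiableOn (by simp)) p p.2)]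
        simp
      map_smul' := fun r F => by
        refine ext_ext fun p => ?_
        have h : EqOn (ext (r • F)) (fun x => r • ext F x) S := fun x hx => by
          simp [ext_apply _ (⟨x, hx⟩ : S)]
        simp only [map_smul, eval_apply, mk_apply, RingHom.id_apply]
        rw [fderivWithin_congr h (h p.2), fderivWithin_fun_const_smul (hS p p.2)
          (((contDiffOn_ext F).differentiableOn (by simp)) p p.2)]
        simp }
    fun F G => by
      refine ext_ext fun p => ?_
      have h : EqOn (ext (F * G)) (fun x => ext F x * ext G x) S := fun x hx => by
        simp [ext_apply _ (⟨x, hx⟩ : S)]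
      simp only [map_add, smul_eq_mul, map_mul, eval_apply, mk_apply, LinearMap.coe_mk,
        AddHom.coe_mk]
      rw [fderivWithin_congr h (h p.2), fderivWithin_fun_mul (hS p p.2)
          (((contDiffOn_ext F).differentiableOn (by simp)) p p.2)
          (((contDiffOn_ext G).differentiableOn (by simp)) p p.2)]
      simp [ext_apply]

variable (hS : UniqueDiffOn ℝ S) {v w : E → E} (hv : ContDiffOn ℝ ∞ v S) (hw : ContDiffOn ℝ ∞ w S)

lemma eval_dirDeriv (F : smoothOn S) (p : S) :
    eval p (dirDeriv hS v hv F) = fderivWithin ℝ (ext F) S p (v p) := rfl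

lemma eval_dirDeriv_of_eqOn (F : smoothOn S) {G : E → ℝ} (h : EqOn (ext F) G S) (p : S) :
    eval p (dirDeriv hS v hv F) = fderivWithin ℝ G S p (v p) := by
  rw [eval_dirDeriv, fderivWithin_congr h (h p.2)]

lemma eval_dirDeriv_dirDeriv (F : smoothOn S) (p : S) :
    eval p (dirDeriv hS v hv (dirDeriv hS w hw F)) =
      fderivWithin ℝ (fun q => fderivWithin ℝ (ext F) S q) S p (v p) (w p)
        + fderivWithin ℝ (ext F) S p (fderivWithin ℝ w S p (v p)) := by
  rw [eval_dirDeriv_of_eqOn hS hv (dirDeriv hS w hw F) (G := fun q =>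
    fderivWithin ℝ (ext F) S q (w q)) (ext_mk _ _)]
  have h1 : DifferentiableWithinAt ℝ (fun q => fderivWithin ℝ (ext F) S q) S p :=
    (((contDiffOn_ext F).fderivWithin hS (m := ∞) le_rfl).differentiableOn (by simp)) p p.2
  have h2 : DifferentiableWithinAt ℝ w S p := (hw.differentiableOn (by simp)) p p.2
  rw [fderivWithin_clm_apply (hS p p.2) h1 h2]
  simp [add_comm]

/-- The second derivatives cancel by symmetry, leaving the Lie bracket. Symmetry is also needed at
boundary points of `S`, where it follows by approximation from the interior. -/
lemma eval_commutator (hS' : S ⊆ closure (interior S)) (F : smoothOn S) (p : S) :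
    eval p (dirDeriv hS v hv (dirDeriv hS w hw F)) - eval p (dirDeriv hS w hw (dirDeriv hS v hv F))
      = fderivWithin ℝ (ext F) S p (fderivWithin ℝ w S p (v p) - fderivWithin ℝ v S p (w p)) := by
  rw [eval_dirDeriv_dirDeriv, eval_dirDeriv_dirDeriv]
  have := (contDiffOn_ext F p p.2).isSymmSndFDerivWithinAt (n := ∞)
    (by rw [minSmoothness_of_isRCLikeNormedField]; exact WithTop.coe_le_coe.2 (le_top : (2 : ℕ∞) ≤ ⊤)) hS (hS' p.2) p.2
  have h2 := this (v p) (w p)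
  rw [h2, map_sub]
  ring

end smoothOn

end SmoothFunctions

/-! ### The space-time domain -/

lemma convex_timeInterval (T : EReal) : Convex ℝ (timeInterval T) := by
  refine Set.OrdConnected.convex ⟨fun a ha b hb c hc => ?_⟩
  exact ⟨ha.1.trans hc.1, lt_of_le_of_lt (EReal.coe_le_coe_iff.2 hc.2) hb.2⟩

lemma isOpen_timeInterval_inter (T : EReal) : IsOpen {t : ℝ | 0 < t ∧ (t : EReal) < T} :=
  isOpen_Ioi.inter (isOpen_Iio.preimage continuous_coe_real_ereal)

lemma subset_interior_timeInterval (T : EReal) :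
    {t : ℝ | 0 < t ∧ (t : EReal) < T} ⊆ interior (timeInterval T) :=
  interior_maximal (fun _ ht => ⟨ht.1.le, ht.2⟩) (isOpen_timeInterval_inter T)

lemma zero_mem_timeInterval {T : EReal} (hT : 0 < T) : (0 : ℝ) ∈ timeInterval T :=
  ⟨le_rfl, by simpa using hT⟩

lemma nonempty_interior_timeInterval {T : EReal} (hT : 0 < T) :
    (interior (timeInterval T)).Nonempty := by
  obtain ⟨r, hr0, hrT⟩ := EReal.lt_iff_exists_real_btwn.1 hT
  exact ⟨r, subset_interior_timeInterval T ⟨by exact_mod_cast hr0, hrT⟩⟩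

/-- The space-time domain of the radially constant extension of a family of maps on the sphere. -/
def spaceTime (n : ℕ) (T : EReal) : Set (ℝ × Ambient n) := timeInterval T ×ˢ {0}ᶜ

lemma uniqueDiffOn_spaceTime (n : ℕ) {T : EReal} (hT : 0 < T) :
    UniqueDiffOn ℝ (spaceTime n T) :=
  (uniqueDiffOn_convex (convex_timeInterval T) (nonempty_interior_timeInterval hT)).prod
    isOpen_compl_singleton.uniqueDiffOn

lemma spaceTime_subset_closure (n : ℕ) {T : EReal} (hT : 0 < T) :
    spaceTime n T ⊆ closure (interior (spaceTime n T)) := by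
  rw [spaceTime, interior_prod_eq, closure_prod_eq,
    (convex_timeInterval T).closure_interior_eq_closure_of_nonempty_interior
      (nonempty_interior_timeInterval hT), isOpen_compl_singleton.interior_eq]
  exact prod_mono subset_closure subset_closure

lemma fderivWithin_fst_eq_zero {V : Type*} [NormedAddCommGroup V] [NormedSpace ℝ V]
    {S : Set (ℝ × V)} (hS : UniqueDiffOn ℝ S) {y : ℝ × V → ℝ × V} {c : ℝ}
    (hy : ContDiffOn ℝ ∞ y S) (hc : ∀ q, (y q).1 = c) {p : ℝ × V} (hp : p ∈ S) (x : ℝ × V) :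
    (fderivWithin ℝ y S p x).1 = 0 := by
  have h1 := (hy.differentiableOn (by simp) p hp).hasFDerivWithinAt.fst
  simp only [hc] at h1
  exact congrArg (fun L => L x) ((hS p hp).eq h1 (hasFDerivWithinAt_const c p S))

/-- Constant time components make the bracket purely spatial. The vector `u` does not depend on `F`,
so it can be read off by testing on the position and on the radius. -/
lemma smoothOn.exists_commutator {V : Type*} [NormedAddCommGroup V] [NormedSpace ℝ V]
    {S : Set (ℝ × V)} (hS : UniqueDiffOn ℝ S) (hS' : S ⊆ closure (interior S))
    {v w : ℝ × V → ℝ × V} (hv : ContDiffOn ℝ ∞ v S) (hw : ContDiffOn ℝ ∞ w S) {r s : ℝ}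
    (hvr : ∀ q, (v q).1 = r) (hws : ∀ q, (w q).1 = s) (p : S) :
    ∃ u : V, ∀ F, eval p (dirDeriv hS v hv (dirDeriv hS w hw F))
      - eval p (dirDeriv hS w hw (dirDeriv hS v hv F)) =
        fderivWithin ℝ (ext F) S p (0, u) := by
  refine ⟨(fderivWithin ℝ w S p (v p) - fderivWithin ℝ v S p (w p)).2, fun F => ?_⟩
  rw [eval_commutator hS hv hw hS']
  congr 1
  refine Prod.ext ?_ rfl
  rw [Prod.fst_sub, fderivWithin_fst_eq_zero hS hw hws p.2,
    fderivWithin_fst_eq_zero hS hv hvr p.2, sub_zero]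

/-! ### The completed frame realizes the algebraic model -/

/-- A family of hypersurfaces and unit normals, parametrized by `ℝ^{n+1} ∖ 0` so that the
parametrization is nondegenerate transversally to the radial direction. -/
structure IsHypersurfaceFamily (n : ℕ) (T : EReal) (X N : ℝ × Ambient n → Ambient n) : Prop where
  smooth : ContDiffOn ℝ ∞ X (spaceTime n T)
  smooth_normal : ContDiffOn ℝ ∞ N (spaceTime n T)
  norm : ∀ p ∈ spaceTime n T, ‖N p‖ = 1
  normal : ∀ p ∈ spaceTime n T, ∀ w, ⟪fderivWithin ℝ X (spaceTime n T) p (0, w), N p⟫_ℝ = 0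
  injective : ∀ p ∈ spaceTime n T, ∀ w, fderivWithin ℝ X (spaceTime n T) p (0, w) = 0 →
    ⟪p.2, w⟫_ℝ = 0 → w = 0

/-- The spatial derivative of the parametrization, completed by mapping the radial direction to the
normal direction. -/
noncomputable def frameMap {n : ℕ} (T : EReal) (X N : ℝ × Ambient n → Ambient n)
    (p : ℝ × Ambient n) : Ambient n →L[ℝ] Ambient n :=
  (fderivWithin ℝ X (spaceTime n T) p).comp (ContinuousLinearMap.inr ℝ ℝ (Ambient n))
    + (innerSL ℝ p.2).smulRight (N p)

namespace IsHypersurfaceFamily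

variable {n : ℕ} {T : EReal} {X N : ℝ × Ambient n → Ambient n}

lemma frameMap_apply (p : ℝ × Ambient n) (w : Ambient n) : frameMap T X N p w =
    fderivWithin ℝ X (spaceTime n T) p (0, w) + ⟪p.2, w⟫_ℝ • N p := by
  simp [frameMap]

variable (h : IsHypersurfaceFamily n T X N)
include h

lemma inner_frameMap {p : ℝ × Ambient n} (hp : p ∈ spaceTime n T) (w : Ambient n) :
    ⟪frameMap T X N p w, N p⟫_ℝ = ⟪p.2, w⟫_ℝ := by
  rw [frameMap_apply, inner_add_left, h.normal p hp, real_inner_smul_left,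
    real_inner_self_eq_norm_sq, h.norm p hp]
  simp

lemma exists_frameEquiv {p : ℝ × Ambient n} (hp : p ∈ spaceTime n T) :
    ∃ e : Ambient n ≃L[ℝ] Ambient n, (e : Ambient n →L[ℝ] Ambient n) = frameMap T X N p := by
  have hinj : Function.Injective (frameMap T X N p : Ambient n →ₗ[ℝ] Ambient n) := by
    rw [← LinearMap.ker_eq_bot, LinearMap.ker_eq_bot']
    intro w hw
    have hw : frameMap T X N p w = 0 := hw
    have h1 : ⟪p.2, w⟫_ℝ = 0 := by rw [← h.inner_frameMap hp, hw, inner_zero_left]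
    refine h.injective p hp w ?_ h1
    rw [frameMap_apply, h1] at hw
    simpa using hw
  refine ⟨(LinearEquiv.ofInjectiveEndo _ hinj).toContinuousLinearEquiv, ?_⟩
  ext w : 1
  rfl

lemma frameMap_inverse {p : ℝ × Ambient n} (hp : p ∈ spaceTime n T) (w : Ambient n) :
    frameMap T X N p ((frameMap T X N p).inverse w) = w := by
  obtain ⟨e, he⟩ := h.exists_frameEquiv hp
  rw [← he, ContinuousLinearMap.inverse_equiv]
  simp

lemma inverse_frameMap {p : ℝ × Ambient n} (hp : p ∈ spaceTime n T) (w : Ambient n) :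
    (frameMap T X N p).inverse (frameMap T X N p w) = w := by
  obtain ⟨e, he⟩ := h.exists_frameEquiv hp
  rw [← he, ContinuousLinearMap.inverse_equiv]
  simp

lemma contDiffOn_inverse (hT : 0 < T) :
    ContDiffOn ℝ ∞ (fun p => (frameMap T X N p).inverse) (spaceTime n T) := by
  have h1 : ContDiffOn ℝ ∞ (frameMap T X N) (spaceTime n T) := by
    have h2 := h.smooth.fderivWithin (uniqueDiffOn_spaceTime n hT) (m := ∞) le_rfl
    have h3 : ContDiffOn ℝ ∞ (fun p : ℝ × Ambient n => innerSL ℝ p.2) (spaceTime n T) :=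
      ((innerSL ℝ).contDiff.comp contDiff_snd).contDiffOn
    exact (h2.clm_comp contDiffOn_const).add (h3.smulRight h.smooth_normal)
  intro p hp
  obtain ⟨e, he⟩ := h.exists_frameEquiv hp
  have := contDiffAt_map_inverse (𝕜 := ℝ) (n := ∞) e
  rw [he] at this
  exact this.comp_contDiffWithinAt p (h1 p hp)

/-- The standard basis vectors pulled back to the parameter space. -/
lemma contDiffOn_frameField (hT : 0 < T) (a : Fin (n + 1)) : ContDiffOn ℝ ∞
    (fun p => ((0 : ℝ), (frameMap T X N p).inverse (EuclideanSpace.single a 1)))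
    (spaceTime n T) :=
  contDiffOn_const.prodMk ((h.contDiffOn_inverse hT).clm_apply contDiffOn_const)

/-- The tangential derivatives of functions on the hypersurfaces, in the ambient directions. -/
noncomputable def D (hT : 0 < T) (a : Fin (n + 1)) :
    Derivation ℝ (smoothOn (spaceTime n T)) (smoothOn (spaceTime n T)) :=
  smoothOn.dirDeriv (uniqueDiffOn_spaceTime n hT) _ (h.contDiffOn_frameField hT a)

omit h in
/-- The time derivative. -/
noncomputable def Dt (n : ℕ) (hT : 0 < T) :
    Derivation ℝ (smoothOn (spaceTime n T)) (smoothOn (spaceTime n T)) :=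
  smoothOn.dirDeriv (uniqueDiffOn_spaceTime n hT) (fun _ => (1, 0)) contDiffOn_const

omit h in
/-- A coordinate of a smooth vector valued function. -/
noncomputable def coord {Y : ℝ × Ambient n → Ambient n} (hY : ContDiffOn ℝ ∞ Y (spaceTime n T))
    (a : Fin (n + 1)) : smoothOn (spaceTime n T) :=
  smoothOn.mk (fun p => Y p a)
    ((EuclideanSpace.proj (𝕜 := ℝ) a).contDiff.comp_contDiffOn hY)

omit h in
@[simp] lemma eval_coord {Y : ℝ × Ambient n → Ambient n} (hY : ContDiffOn ℝ ∞ Y (spaceTime n T))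
    (a : Fin (n + 1)) (p : spaceTime n T) : smoothOn.eval p (coord hY a) = Y p a := rfl

omit h in
lemma ext_coord {Y : ℝ × Ambient n → Ambient n} (hY : ContDiffOn ℝ ∞ Y (spaceTime n T))
    (a : Fin (n + 1)) : EqOn (smoothOn.ext (coord hY a)) (fun p => Y p a) (spaceTime n T) :=
  smoothOn.ext_mk _ _

omit h in
/-- Half the squared length of the parameter. -/
noncomputable def radius (n : ℕ) (T : EReal) : smoothOn (spaceTime n T) :=
  smoothOn.mk (fun p => ⟪p.2, p.2⟫_ℝ / 2)
    ((contDiff_snd.inner ℝ contDiff_snd).div_const 2).contDiffOn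

omit h in
lemma ext_radius : EqOn (smoothOn.ext (radius n T)) (fun p => ⟪p.2, p.2⟫_ℝ / 2) (spaceTime n T) :=
  smoothOn.ext_mk _ _

omit h in
lemma fderivWithin_coord (hT : 0 < T) {Y : ℝ × Ambient n → Ambient n}
    (hY : ContDiffOn ℝ ∞ Y (spaceTime n T)) (a : Fin (n + 1)) {p : ℝ × Ambient n}
    (hp : p ∈ spaceTime n T) (v : ℝ × Ambient n) :
    fderivWithin ℝ (smoothOn.ext (coord hY a)) (spaceTime n T) p v =
      fderivWithin ℝ Y (spaceTime n T) p v a := by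
  rw [fderivWithin_congr (ext_coord hY a) (ext_coord hY a hp)]
  have h1 := (hY.differentiableOn (by simp) p hp).hasFDerivWithinAt
  have h2 := ((EuclideanSpace.proj (𝕜 := ℝ) a).hasFDerivAt (x := Y p)).comp_hasFDerivWithinAt p h1
  rw [HasFDerivWithinAt.fderivWithin (f := fun p => Y p a) h2 (uniqueDiffOn_spaceTime n hT p hp)]
  rfl

omit h in
lemma fderivWithin_radius (hT : 0 < T) {p : ℝ × Ambient n}
    (hp : p ∈ spaceTime n T) (v : ℝ × Ambient n) :
    fderivWithin ℝ (smoothOn.ext (radius n T)) (spaceTime n T) p v = ⟪p.2, v.2⟫_ℝ := by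
  rw [fderivWithin_congr ext_radius (ext_radius hp)]
  have h1 : HasFDerivAt (fun p : ℝ × Ambient n => p.2) (ContinuousLinearMap.snd ℝ ℝ (Ambient n)) p :=
    hasFDerivAt_snd
  have h2 := ((h1.inner ℝ h1).mul_const (2⁻¹ : ℝ))
  simp only [← div_eq_mul_inv] at h2
  rw [h2.hasFDerivWithinAt.fderivWithin (uniqueDiffOn_spaceTime n hT p hp)]
  simp [real_inner_comm]
  ring

/-- Expand `w` in the fields defining `D c`. Its coefficients are the components of `frameMap` at
`w`, that is, the derivative of `X c` plus `N c` times the derivative of `radius`; this yields the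
commutator axioms of the algebraic model. -/
lemma fderivWithin_spatial (hT : 0 < T) (F : smoothOn (spaceTime n T)) (p : spaceTime n T)
    (w : Ambient n) : fderivWithin ℝ (smoothOn.ext F) (spaceTime n T) p (0, w) =
      ∑ c, (fderivWithin ℝ (smoothOn.ext (coord h.smooth c)) (spaceTime n T) p (0, w)
        + smoothOn.eval p (coord h.smooth_normal c)
          * fderivWithin ℝ (smoothOn.ext (radius n T)) (spaceTime n T) p (0, w))
        * smoothOn.eval p (h.D hT c F) := by
  have hw : w = ∑ c, (frameMap T X N p w) c •
      (frameMap T X N p).inverse (EuclideanSpace.single c 1) := by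
    conv_lhs => rw [← h.inverse_frameMap p.2 w]
    simp only [← map_smul, ← map_sum]
    congr 1
    ext i
    simp [Pi.single_apply]
  have hw' : ((0 : ℝ), w) = ∑ c, (frameMap T X N p w) c •
      ((0 : ℝ), (frameMap T X N p).inverse (EuclideanSpace.single c 1)) := by
    refine Prod.ext ?_ ?_
    · simp [Prod.fst_sum]
    · simpa [Prod.snd_sum] using hw
  conv_lhs => rw [hw', map_sum]
  refine Finset.sum_congr rfl fun c _ => ?_
  rw [map_smul, D, smoothOn.eval_dirDeriv, fderivWithin_coord hT _ _ p.2,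
    fderivWithin_radius hT p.2, frameMap_apply, eval_coord]
  simp [mul_comm]

lemma isSurfaceFrame (hT : 0 < T) :
    IsSurfaceFrame (h.D hT) (coord h.smooth) (coord h.smooth_normal) (radius n T) where
  deriv_rho a := by
    refine smoothOn.ext_ext fun p => ?_
    rw [D, smoothOn.eval_dirDeriv, fderivWithin_radius hT p.2, ← h.inner_frameMap p.2,
      h.frameMap_inverse p.2]
    rw [eval_coord]
    simp [EuclideanSpace.inner_single_left]
  deriv_pos a b := by
    refine smoothOn.ext_ext fun p => ?_
    have h1 := h.frameMap_inverse p.2 (EuclideanSpace.single a 1)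
    rw [frameMap_apply, ← h.inner_frameMap p.2, h.frameMap_inverse p.2] at h1
    have h2 := congrArg (fun v => v b) h1
    rw [D, smoothOn.eval_dirDeriv, fderivWithin_coord hT _ _ p.2]
    simp only [PiLp.add_apply, PiLp.smul_apply, EuclideanSpace.inner_single_left] at h2
    rw [map_sub, map_mul]
    have h3 : smoothOn.eval p (if a = b then 1 else 0) = (EuclideanSpace.single a (1 : ℝ)) b := by
      simp only [PiLp.single_apply, eq_comm]
      split_ifs <;> simp
    rw [h3]
    rw [← h2, eval_coord, eval_coord]; simp
  norm := by
    refine smoothOn.ext_ext fun p => ?_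
    have := h.norm p p.2
    rw [EuclideanSpace.norm_eq, Real.sqrt_eq_one] at this
    simp only [map_sum, map_mul, eval_coord, map_one]
    simpa [pow_two] using this
  comm a b F := by
    refine smoothOn.ext_ext fun p => ?_
    simp only [map_sub, map_sum, map_mul, map_add]
    obtain ⟨w, hw⟩ : ∃ w : Ambient n, ∀ G, smoothOn.eval p (h.D hT a (h.D hT b G))
        - smoothOn.eval p (h.D hT b (h.D hT a G)) =
          fderivWithin ℝ (smoothOn.ext G) (spaceTime n T) p (0, w) :=
      smoothOn.exists_commutator (uniqueDiffOn_spaceTime n hT) (spaceTime_subset_closure n hT)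
        (h.contDiffOn_frameField hT a) (h.contDiffOn_frameField hT b) (fun _ => rfl)
        (fun _ => rfl) p
    rw [hw, h.fderivWithin_spatial hT]
    simp only [hw]

end IsHypersurfaceFamily

/-! ### The flow realizes the algebraic model -/

/-- A family of hypersurfaces moving by `∂X/∂t = f N - κ X`, where `f` is the inverse of the mean
curvature. -/
structure IsFlowFamily (n : ℕ) (T : EReal) (X N : ℝ × Ambient n → Ambient n) (hT : 0 < T) (κ : ℝ) :
    Prop extends IsHypersurfaceFamily n T X N where
  meanCurvature_pos : ∀ p, 0 < smoothOn.eval p (IsSurfaceFrame.meanCurvature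
    (toIsHypersurfaceFamily.D hT) (IsHypersurfaceFamily.coord smooth_normal))
  evolution : ∀ p : spaceTime n T, fderivWithin ℝ X (spaceTime n T) p (1, 0) =
    (smoothOn.eval p (IsSurfaceFrame.meanCurvature
      (toIsHypersurfaceFamily.D hT) (IsHypersurfaceFamily.coord smooth_normal)))⁻¹ • N p - κ • X p

namespace IsFlowFamily

open IsHypersurfaceFamily

variable {n : ℕ} {T : EReal} {X N : ℝ × Ambient n → Ambient n} {hT : 0 < T} {κ : ℝ}
  (h : IsFlowFamily n T X N hT κ)
include h

/-- The mean curvature as a smooth function on space-time. -/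
noncomputable def H : smoothOn (spaceTime n T) :=
  IsSurfaceFrame.meanCurvature (h.D hT) (coord h.smooth_normal)

/-- The speed of the inverse mean curvature flow. -/
noncomputable def speed : smoothOn (spaceTime n T) :=
  smoothOn.mk (fun p => (smoothOn.ext h.H p)⁻¹) ((smoothOn.contDiffOn_ext h.H).inv fun p hp => by
    rw [smoothOn.ext_apply _ ⟨p, hp⟩]
    exact (h.meanCurvature_pos ⟨p, hp⟩).ne')

lemma eval_speed (p : spaceTime n T) :
    smoothOn.eval p h.speed = (smoothOn.eval p h.H)⁻¹ := by
  rw [smoothOn.eval_apply (F := h.H), ← smoothOn.ext_apply]; rfl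

lemma isInverseCurvatureFlow : IsInverseCurvatureFlow (h.D hT) (coord h.smooth)
    (coord h.smooth_normal) (radius n T) (Dt n hT) h.speed κ where
  toIsSurfaceFrame := h.isSurfaceFrame hT
  speed := by
    refine smoothOn.ext_ext fun p => ?_
    rw [map_mul]
    rw [eval_speed]
    exact inv_mul_cancel₀ (h.meanCurvature_pos p).ne'
  deriv_time_rho := by
    refine smoothOn.ext_ext fun p => ?_
    rw [Dt, smoothOn.eval_dirDeriv, fderivWithin_radius hT p.2]
    simp
  deriv_time_pos b := by
    refine smoothOn.ext_ext fun p => ?_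
    rw [Dt, smoothOn.eval_dirDeriv, fderivWithin_coord hT _ _ p.2, h.evolution p, map_sub, map_mul,
      map_smul, eval_coord, eval_coord, eval_speed]
    rfl
  comm_time a F := by
    refine smoothOn.ext_ext fun p => ?_
    simp only [map_sub, map_sum, map_mul, map_add]
    obtain ⟨w, hw⟩ : ∃ w : Ambient n, ∀ G, smoothOn.eval p (Dt n hT (h.D hT a G))
        - smoothOn.eval p (h.D hT a (Dt n hT G)) =
          fderivWithin ℝ (smoothOn.ext G) (spaceTime n T) p (0, w) :=
      smoothOn.exists_commutator (uniqueDiffOn_spaceTime n hT) (spaceTime_subset_closure n hT)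
        contDiffOn_const (h.contDiffOn_frameField hT a) (fun _ => rfl) (fun _ => rfl) p
    rw [hw, h.fderivWithin_spatial hT]
    simp only [hw]

end IsFlowFamily

/-! ### First and second order conditions at a minimum -/

/-- The second derivative is nonnegative at a local minimum. -/
lemma IsLocalMin.deriv_deriv_nonneg {g : ℝ → ℝ} {x l : ℝ} (h : IsLocalMin g x)
    (hc : ContinuousAt g x) (hl : HasDerivAt (deriv g) l x) : 0 ≤ l := by
  by_contra! hneg
  have hmax := isLocalMax_of_deriv_deriv_neg (by rw [hl.deriv]; exact hneg) h.deriv_eq_zero hc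
  have hconst : g =ᶠ[𝓝 x] fun _ => g x := by
    filter_upwards [h, hmax] with y h1 h2 using le_antisymm h2 h1
  have h1 : deriv g =ᶠ[𝓝 x] fun _ => 0 := by
    simpa using hconst.deriv
  have h2 := hl.congr_of_eventuallyEq h1.symm
  exact hneg.ne (h2.unique (hasDerivAt_const x 0))

section Calculus

variable {E : Type*} [NormedAddCommGroup E] [NormedSpace ℝ E] {S : Set E} {G : E → ℝ} {p : E}

lemma hasFDerivAt_of_contDiffOn (hG : ContDiffOn ℝ ∞ G S) {q : E} (hq : S ∈ 𝓝 q) :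
    HasFDerivAt G (fderivWithin ℝ G S q) q := by
  rw [fderivWithin_of_mem_nhds hq]
  exact ((hG.contDiffAt hq).differentiableAt (by simp)).hasFDerivAt

lemma hasDerivAt_line (p v : E) (s : ℝ) : HasDerivAt (fun s : ℝ => p + s • v) v s := by
  simpa using ((hasDerivAt_id s).smul_const v).const_add p

lemma hasDerivAt_comp_line (hG : ContDiffOn ℝ ∞ G S) {v : E} {s : ℝ} (hs : S ∈ 𝓝 (p + s • v)) :
    HasDerivAt (fun s : ℝ => G (p + s • v)) (fderivWithin ℝ G S (p + s • v) v) s :=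
  (hasFDerivAt_of_contDiffOn hG hs).comp_hasDerivAt s (hasDerivAt_line p v s)

lemma eventually_mem_nhds_line (hp : S ∈ 𝓝 p) (v : E) :
    ∀ᶠ s in 𝓝 (0 : ℝ), S ∈ 𝓝 (p + s • v) := by
  have hc : Tendsto (fun s : ℝ => p + s • v) (𝓝 0) (𝓝 p) := by
    have := (hasDerivAt_line p v 0).continuousAt.tendsto
    simpa using this
  exact hc.eventually (eventually_mem_nhds_iff.2 hp)

lemma fderivWithin_eq_zero_of_line_min (hp : S ∈ 𝓝 p) (hG : ContDiffOn ℝ ∞ G S) {v : E}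
    (hmin : ∀ᶠ s in 𝓝 (0 : ℝ), G p ≤ G (p + s • v)) : fderivWithin ℝ G S p v = 0 := by
  have h1 := hasDerivAt_comp_line (p := p) (v := v) (s := 0) hG (by simpa using hp)
  have h2 : IsLocalMin (fun s : ℝ => G (p + s • v)) 0 := by
    filter_upwards [hmin] with s hs
    simpa using hs
  simpa using h2.hasDerivAt_eq_zero h1

lemma fderivWithin_fderivWithin_nonneg_of_line_min (hp : S ∈ 𝓝 p) (hS : UniqueDiffOn ℝ S)
    (hG : ContDiffOn ℝ ∞ G S) {v : E} (hmin : ∀ᶠ s in 𝓝 (0 : ℝ), G p ≤ G (p + s • v)) :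
    0 ≤ fderivWithin ℝ (fun q => fderivWithin ℝ G S q) S p v v := by
  have h1 := hasDerivAt_comp_line (p := p) (v := v) (s := 0) hG (by simpa using hp)
  have h2 : IsLocalMin (fun s : ℝ => G (p + s • v)) 0 := by
    filter_upwards [hmin] with s hs
    simpa using hs
  have h3 : deriv (fun s : ℝ => G (p + s • v)) =ᶠ[𝓝 0]
      fun s => fderivWithin ℝ G S (p + s • v) v := by
    filter_upwards [eventually_mem_nhds_line hp v] with s hs
    exact (hasDerivAt_comp_line hG hs).deriv
  have h4 : ContDiffOn ℝ ∞ (fun q => fderivWithin ℝ G S q v) S :=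
    (hG.fderivWithin hS le_rfl).clm_apply contDiffOn_const
  have h5 := hasDerivAt_comp_line (p := p) (v := v) (s := 0) h4 (by simpa using hp)
  have h6 := h2.deriv_deriv_nonneg h1.continuousAt (h5.congr_of_eventuallyEq h3)
  have hpS : p ∈ S := mem_of_mem_nhds hp
  have h7 : DifferentiableWithinAt ℝ (fun q => fderivWithin ℝ G S q) S p :=
    ((hG.fderivWithin hS (m := ∞) le_rfl).differentiableOn (by simp)) p hpS
  simp only [zero_smul, add_zero] at h6
  rw [fderivWithin_clm_apply (hS p hpS) h7 (differentiableWithinAt_const v)] at h6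
  simpa using h6

lemma fderivWithin_nonpos_of_line_left (hp : S ∈ 𝓝 p) (hG : ContDiffOn ℝ ∞ G S) {v : E}
    (hmin : ∀ᶠ s in 𝓝[<] (0 : ℝ), G p ≤ G (p + s • v)) : fderivWithin ℝ G S p v ≤ 0 := by
  have h1 := hasDerivAt_comp_line (p := p) (v := v) (s := 0) hG (by simpa using hp)
  simp only [zero_smul, add_zero] at h1
  refine le_of_tendsto h1.tendsto_slope_zero_left ?_
  filter_upwards [hmin, self_mem_nhdsWithin] with s hs hs0
  have hs0 : s < 0 := hs0
  simp only [zero_add, zero_smul, add_zero, smul_eq_mul]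
  exact mul_nonpos_of_nonpos_of_nonneg (inv_nonpos.2 hs0.le) (sub_nonneg.2 hs)

end Calculus

lemma spaceTime_mem_nhds {n : ℕ} {T : EReal} {p : ℝ × Ambient n} (hp : p ∈ spaceTime n T)
    (h0 : 0 < p.1) : spaceTime n T ∈ 𝓝 p := by
  rw [← p.eta, spaceTime]
  exact prod_mem_nhds (mem_interior_iff_mem_nhds.1 (subset_interior_timeInterval T ⟨h0, hp.1.2⟩))
    (isOpen_compl_singleton.mem_nhds hp.2)

namespace IsHypersurfaceFamily

variable {n : ℕ} {T : EReal} {X N : ℝ × Ambient n → Ambient n} (h : IsHypersurfaceFamily n T X N)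
include h

omit h in
lemma eval_deriv_time_nonpos (hT : 0 < T) {p : spaceTime n T} (h0 : 0 < p.1.1)
    {G : smoothOn (spaceTime n T)} (hG : ∀ q : spaceTime n T, q.1.1 ≤ p.1.1 →
      smoothOn.eval p G ≤ smoothOn.eval q G) : smoothOn.eval p (Dt n hT G) ≤ 0 := by
  rw [Dt, smoothOn.eval_dirDeriv]
  have hp := spaceTime_mem_nhds p.2 h0
  refine fderivWithin_nonpos_of_line_left hp (smoothOn.contDiffOn_ext G) ?_
  filter_upwards [(eventually_mem_nhds_line hp (1, 0)).filter_mono nhdsWithin_le_nhds,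
    self_mem_nhdsWithin] with s hs hs0
  have hs0 : s < 0 := hs0
  rw [smoothOn.ext_apply G p, smoothOn.ext_apply G ⟨_, mem_of_mem_nhds hs⟩]
  exact hG ⟨_, mem_of_mem_nhds hs⟩ (by simpa using hs0.le)

/-- Applying the field of `D c` twice gives its Hessian term plus the derivative of `G` along the
field's own derivative. That direction is spatial, so the second term vanishes at a spatial minimum.
-/
lemma eval_deriv_deriv_nonneg (hT : 0 < T) {p : spaceTime n T} (h0 : 0 < p.1.1)
    {G : smoothOn (spaceTime n T)} (hG : ∀ q : spaceTime n T, q.1.1 ≤ p.1.1 →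
      smoothOn.eval p G ≤ smoothOn.eval q G) (c : Fin (n + 1)) :
    0 ≤ smoothOn.eval p (h.D hT c (h.D hT c G)) := by
  have hp := spaceTime_mem_nhds p.2 h0
  have hmin : ∀ w : Ambient n, ∀ᶠ s in 𝓝 (0 : ℝ),
      smoothOn.ext G p ≤ smoothOn.ext G (p + s • ((0 : ℝ), w)) := by
    intro w
    filter_upwards [eventually_mem_nhds_line hp (0, w)] with s hs
    rw [smoothOn.ext_apply G p, smoothOn.ext_apply G ⟨_, mem_of_mem_nhds hs⟩]
    exact hG ⟨_, mem_of_mem_nhds hs⟩ (by simp)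
  rw [D, smoothOn.eval_dirDeriv_dirDeriv]
  have hd : (fderivWithin ℝ (fun p => ((0 : ℝ), (frameMap T X N p).inverse
      (EuclideanSpace.single c 1))) (spaceTime n T) p
        (0, (frameMap T X N p).inverse (EuclideanSpace.single c 1))).1 = 0 :=
    fderivWithin_fst_eq_zero (uniqueDiffOn_spaceTime n hT) (h.contDiffOn_frameField hT c)
      (fun _ => rfl) p.2 _
  have h1 := fderivWithin_fderivWithin_nonneg_of_line_min hp (uniqueDiffOn_spaceTime n hT)
    (smoothOn.contDiffOn_ext G) (hmin ((frameMap T X N p).inverse (EuclideanSpace.single c 1)))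
  refine add_nonneg h1 (le_of_eq (Eq.symm ?_))
  rw [← Prod.eta (fderivWithin ℝ (fun p => ((0 : ℝ), (frameMap T X N p).inverse
      (EuclideanSpace.single c 1))) (spaceTime n T) p _), hd]
  exact fderivWithin_eq_zero_of_line_min hp (smoothOn.contDiffOn_ext G) (hmin _)

/-- The pinching quantity `h(ξ, ξ) - η H g(ξ, ξ)` at a point of space-time. -/
noncomputable def pinchAt (hT : 0 < T) (p : spaceTime n T) (η : ℝ) (ξ : Ambient n) : ℝ :=
  ∑ a, ∑ b, smoothOn.eval p (h.D hT a (coord h.smooth_normal b)) * ξ a * ξ b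
    - η * (smoothOn.eval p (IsSurfaceFrame.meanCurvature (h.D hT) (coord h.smooth_normal))
      * (⟪ξ, ξ⟫_ℝ - ⟪N p, ξ⟫_ℝ * ⟪N p, ξ⟫_ℝ))

omit h in
lemma inner_eq_sum (u v : Ambient n) : ⟪u, v⟫_ℝ = ∑ b, u b * v b := by
  simp [PiLp.inner_apply, mul_comm]

lemma eval_pinch (hT : 0 < T) (p : spaceTime n T) (η : smoothOn (spaceTime n T))
    (ξ : Fin (n + 1) → smoothOn (spaceTime n T)) :
    smoothOn.eval p (IsSurfaceFrame.pinch (h.D hT) (coord h.smooth_normal) ξ η) =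
      h.pinchAt hT p (smoothOn.eval p η) (WithLp.toLp 2 fun b => smoothOn.eval p (ξ b)) := by
  rw [IsSurfaceFrame.pinch, IsSurfaceFrame.shapeForm, IsSurfaceFrame.tangentSq, pinchAt]
  simp only [map_sub, map_mul, map_sum, inner_eq_sum, eval_coord]

/-- A minimizer of the pinching quantity among all vectors is an eigenvector. -/
lemma eigenvector_of_pinchAt_eq_zero (hT : 0 < T) {p : spaceTime n T} {η : ℝ} {ξ : Ambient n}
    (hnonneg : ∀ ζ, 0 ≤ h.pinchAt hT p η ζ) (h0 : h.pinchAt hT p η ξ = 0) (hN : ⟪N p, ξ⟫_ℝ = 0)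
    (b : Fin (n + 1)) : ∑ a, smoothOn.eval p (h.D hT a (coord h.smooth_normal b)) * ξ a =
      η * smoothOn.eval p (IsSurfaceFrame.meanCurvature (h.D hT) (coord h.smooth_normal)) * ξ b := by
  set w : Fin (n + 1) → Fin (n + 1) → ℝ :=
    fun a b => smoothOn.eval p (h.D hT a (coord h.smooth_normal b)) with hw
  set m := smoothOn.eval p (IsSurfaceFrame.meanCurvature (h.D hT) (coord h.smooth_normal)) with hm
  have hsymm : ∀ a b, w a b = w b a := fun a b => by
    simp only [hw, (h.isSurfaceFrame hT).shape_symm a b]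
  set e : Ambient n := EuclideanSpace.single b 1 with he
  have hexp : ∀ s : ℝ, h.pinchAt hT p η (ξ + s • e) =
      2 * s * (∑ a, w a b * ξ a - η * m * ξ b) + s ^ 2 * h.pinchAt hT p η e := by
    intro s
    have h1 : ∑ a, ∑ c, w a c * (ξ + s • e) a * (ξ + s • e) c =
        ∑ a, ∑ c, w a c * ξ a * ξ c + 2 * s * ∑ a, w a b * ξ a
          + s ^ 2 * ∑ a, ∑ c, w a c * e a * e c := by
      have h2 : ∀ a c, w a c * (ξ + s • e) a * (ξ + s • e) c = w a c * ξ a * ξ c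
          + s * (w a c * ξ a * e c) + s * (w c a * ξ c * e a) + s ^ 2 * (w a c * e a * e c) := by
        intro a c
        rw [hsymm c a]
        simp only [PiLp.add_apply, PiLp.smul_apply, smul_eq_mul]; ring
      have h3 : ∑ a, ∑ c, w c a * ξ c * e a = ∑ a, ∑ c, w a c * ξ a * e c := Finset.sum_comm
      have h4 : ∑ a, ∑ c, w a c * ξ a * e c = ∑ a, w a b * ξ a := by
        simp [he]
      simp only [h2, Finset.sum_add_distrib, ← Finset.mul_sum, h3, h4]
      ring
    have h0' := h0
    rw [pinchAt] at h0' ⊢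
    rw [pinchAt]
    have h5 : ⟪ξ + s • e, ξ + s • e⟫_ℝ = ⟪ξ, ξ⟫_ℝ + 2 * s * ξ b + s ^ 2 * ⟪e, e⟫_ℝ := by
      have : ⟪ξ, e⟫_ℝ = ξ b := by simp [he, EuclideanSpace.inner_single_right]
      simp only [inner_add_left, inner_add_right, real_inner_smul_left, real_inner_smul_right,
        real_inner_comm ξ e, this]
      ring
    rw [h1, h5, inner_add_right, real_inner_smul_right, hN]
    rw [hN] at h0'
    linear_combination h0'
  set β := ∑ a, w a b * ξ a - η * m * ξ b with hβ
  have hq : ∀ s : ℝ, 0 ≤ 2 * s * β + s ^ 2 * h.pinchAt hT p η e := fun s => by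
    rw [← hexp]; exact hnonneg _
  have hβ0 : β = 0 := by
    have h1 := hnonneg e
    -- The quadratic `2sβ + s²c` is nonnegative for all `s`. Dividing by `c + 1` instead of `c`
    -- covers the case `c = 0` too.
    have h2 := hq (-β / (h.pinchAt hT p η e + 1))
    have h3 : 0 < h.pinchAt hT p η e + 1 := by linarith
    set c := h.pinchAt hT p η e
    have h4 : 2 * (-β / (c + 1)) * β + (-β / (c + 1)) ^ 2 * c =
        - (β ^ 2 * (c + 2) / (c + 1) ^ 2) := by
      field_simp; ring
    rw [h4] at h2
    have h5 : 0 ≤ β ^ 2 * (c + 2) / (c + 1) ^ 2 := by positivity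
    have h6 : β ^ 2 * (c + 2) / (c + 1) ^ 2 = 0 := le_antisymm (by linarith) h5
    rcases div_eq_zero_iff.1 h6 with h7 | h7
    · rcases mul_eq_zero.1 h7 with h8 | h8
      · exact pow_eq_zero_iff two_ne_zero |>.1 h8
      · linarith
    · exact absurd h7 (by positivity)
  linarith

end IsHypersurfaceFamily

namespace IsHypersurfaceFamily

open IsSurfaceFrame

variable {n : ℕ} {T : EReal} {X N : ℝ × Ambient n → Ambient n} (h : IsHypersurfaceFamily n T X N)
include h

lemma pinchAt_sub (hT : 0 < T) (p : spaceTime n T) (η d : ℝ) (ξ : Ambient n) :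
    h.pinchAt hT p (η - d) ξ = h.pinchAt hT p η ξ
      + d * (smoothOn.eval p (meanCurvature (h.D hT) (coord h.smooth_normal))
        * (⟪ξ, ξ⟫_ℝ - ⟪N p, ξ⟫_ℝ * ⟪N p, ξ⟫_ℝ)) := by
  rw [pinchAt, pinchAt]; ring

lemma pinchAt_smul (hT : 0 < T) (p : spaceTime n T) (η s : ℝ) (ξ : Ambient n) :
    h.pinchAt hT p η (s • ξ) = s ^ 2 * h.pinchAt hT p η ξ := by
  rw [pinchAt, pinchAt]
  have : ∀ a b, smoothOn.eval p (h.D hT a (coord h.smooth_normal b)) * (s • ξ) a * (s • ξ) b =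
      s ^ 2 * (smoothOn.eval p (h.D hT a (coord h.smooth_normal b)) * ξ a * ξ b) := by
    intro a b
    simp only [PiLp.smul_apply, smul_eq_mul]; ring
  simp only [this, ← Finset.mul_sum, real_inner_smul_left, real_inner_smul_right]
  ring

lemma inner_normal_self (p : spaceTime n T) : ⟪N p, N p⟫_ℝ = 1 := by
  rw [real_inner_self_eq_norm_sq, h.norm p p.2, one_pow]

/-- The normal lies in the kernel of both the shape operator and the tangential projection. Hence
nonnegativity on tangent vectors and on all ambient vectors are equivalent, and extensions of `ξ`
need not stay tangent. -/
lemma pinchAt_add_normal (hT : 0 < T) (p : spaceTime n T) (η s : ℝ) (ξ : Ambient n) :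
    h.pinchAt hT p η (ξ + s • N p) = h.pinchAt hT p η ξ := by
  have hS := h.isSurfaceFrame hT
  rw [pinchAt, pinchAt]
  have h1 : ∀ a, ∑ b, smoothOn.eval p (h.D hT a (coord h.smooth_normal b)) * N p b = 0 := by
    intro a
    have := congrArg (smoothOn.eval p) (hS.sum_mul_normal a)
    simpa only [map_sum, map_mul, eval_coord, map_zero] using this
  have h2 : ∀ b, ∑ a, smoothOn.eval p (h.D hT a (coord h.smooth_normal b)) * N p a = 0 := by
    intro b
    simp_rw [fun a => hS.shape_symm a b]
    exact h1 b
  have h3 : ∀ a b, smoothOn.eval p (h.D hT a (coord h.smooth_normal b)) * (ξ + s • N p) a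
      * (ξ + s • N p) b = smoothOn.eval p (h.D hT a (coord h.smooth_normal b)) * ξ a * ξ b
      + ξ a * (s * (smoothOn.eval p (h.D hT a (coord h.smooth_normal b)) * N p b))
      + s * ((smoothOn.eval p (h.D hT a (coord h.smooth_normal b)) * N p a) * (ξ + s • N p) b) := by
    intro a b
    simp only [PiLp.add_apply, PiLp.smul_apply, smul_eq_mul]; ring
  have h4 : ∑ a, ∑ b, smoothOn.eval p (h.D hT a (coord h.smooth_normal b)) * N p a
      * (ξ + s • N p) b = 0 := by
    rw [Finset.sum_comm]
    simp only [← Finset.sum_mul, h2]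
    simp
  simp only [h3, Finset.sum_add_distrib, ← Finset.mul_sum, h1, h4]
  simp only [inner_add_left, inner_add_right, real_inner_smul_left, real_inner_smul_right,
    h.inner_normal_self, real_inner_comm (N p) ξ, mul_zero, Finset.sum_const_zero]
  ring

lemma pinchAt_nonneg_of_unit (hT : 0 < T) (p : spaceTime n T) (η : ℝ)
    (hu : ∀ ξ : Ambient n, ‖ξ‖ = 1 → ⟪N p, ξ⟫_ℝ = 0 → 0 ≤ h.pinchAt hT p η ξ) (ξ : Ambient n) :
    0 ≤ h.pinchAt hT p η ξ := by
  have h1 := h.pinchAt_add_normal hT p η (-⟪N p, ξ⟫_ℝ) ξ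
  set ζ := ξ + (-⟪N p, ξ⟫_ℝ) • N p with hζ
  have hζN : ⟪N p, ζ⟫_ℝ = 0 := by
    rw [hζ, inner_add_right, real_inner_smul_right, h.inner_normal_self]; ring
  rw [← h1]
  rcases eq_or_ne ζ 0 with h0 | h0
  · have := h.pinchAt_smul hT p η 0 0
    rw [h0]; simpa using this.ge
  · have h2 : ζ = ‖ζ‖ • (‖ζ‖⁻¹ • ζ) := by
      rw [smul_smul, mul_inv_cancel₀ (norm_ne_zero_iff.2 h0), one_smul]
    rw [h2, h.pinchAt_smul]
    refine mul_nonneg (sq_nonneg _) (hu _ ?_ ?_)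
    · rw [norm_smul, norm_inv, norm_norm, inv_mul_cancel₀ (norm_ne_zero_iff.2 h0)]
    · rw [real_inner_smul_right, hζN, mul_zero]

end IsHypersurfaceFamily

/-! ### The maximum principle -/

namespace IsFlowFamily

open IsHypersurfaceFamily IsSurfaceFrame

variable {n : ℕ} {T : EReal} {X N : ℝ × Ambient n → Ambient n} {hT : 0 < T} {κ : ℝ}
  (h : IsFlowFamily n T X N hT κ)
include h

/-- The perturbed pinching quantity cannot have a first zero. -/
lemma no_first_contact (hn : 1 ≤ n) {ε δ C : ℝ} (hε0 : 0 ≤ ε) (hε1 : n * ε ≤ 1) (hδ : 0 < δ)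
    {p : spaceTime n T} (h0 : 0 < p.1.1) {ξ : Ambient n} (hξ : ⟪ξ, ξ⟫_ℝ = 1)
    (hξN : ⟪N p, ξ⟫_ℝ = 0) (hd : δ * Real.exp (C * p.1.1) ≤ 1)
    (hC : 2 * (smoothOn.eval p (normSq (h.D hT) (coord h.smooth_normal)) * smoothOn.eval p h.H ^ 2
      + smoothOn.eval p h.H ^ 4)
      + 2 * (n + 1) * ∑ c, smoothOn.eval p (h.D hT c h.H) ^ 2 < C * smoothOn.eval p h.H ^ 4)
    (hnonneg : ∀ q : spaceTime n T, q.1.1 ≤ p.1.1 → ∀ ζ,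
      0 ≤ h.pinchAt hT q (ε - δ * Real.exp (C * q.1.1)) ζ)
    (hzero : h.pinchAt hT p (ε - δ * Real.exp (C * p.1.1)) ξ = 0) : False := by
  have hF := h.isInverseCurvatureFlow
  have hS := h.isSurfaceFrame hT
  have hη : ContDiff ℝ ∞ fun q : ℝ × Ambient n => ε - δ * Real.exp (C * q.1) := by fun_prop
  set ηf : smoothOn (spaceTime n T) :=
    smoothOn.mk (fun q => ε - δ * Real.exp (C * q.1)) hη.contDiffOn with hηf
  have heta : ∀ q : spaceTime n T, smoothOn.eval q ηf = ε - δ * Real.exp (C * q.1.1) :=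
    fun q => rfl
  have hder : ∀ q : spaceTime n T, ∀ v, fderivWithin ℝ (smoothOn.ext ηf) (spaceTime n T) q v =
      -(C * (δ * Real.exp (C * q.1.1))) * v.1 := by
    intro q v
    have he : EqOn (smoothOn.ext ηf) (fun q => ε - δ * Real.exp (C * q.1)) (spaceTime n T) :=
      smoothOn.ext_mk _ _
    rw [fderivWithin_congr he (he q.2)]
    have h1 : HasFDerivAt (fun q : ℝ × Ambient n => q.1)
      (ContinuousLinearMap.fst ℝ ℝ (Ambient n)) q.1 := hasFDerivAt_fst
    have h2 := (((h1.const_mul C).exp).const_mul δ).const_sub ε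
    rw [h2.hasFDerivWithinAt.fderivWithin (uniqueDiffOn_spaceTime n hT q q.2)]
    simp; ring
  have hDη : ∀ a, h.D hT a ηf = 0 := by
    intro a
    refine smoothOn.ext_ext fun q => ?_
    rw [D, smoothOn.eval_dirDeriv, hder]
    simp
  have hDtη : smoothOn.eval p (Dt n hT ηf) = -(C * (δ * Real.exp (C * p.1.1))) := by
    rw [Dt, smoothOn.eval_dirDeriv, hder]; simp
  set H := smoothOn.eval p h.H with hH
  have hHpos : 0 < H := h.meanCurvature_pos p
  set η := ε - δ * Real.exp (C * p.1.1) with hηdef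
  set g := ∑ b, smoothOn.eval p (h.D hT b h.H) * ξ b with hg
  -- The value of `k` minimizing the part of the Laplacian of the pinching quantity that depends on
  -- the extension.
  obtain ⟨k, hk⟩ : ∃ k : ℝ, k = -((1 - η) * g / ((1 - n * η) * H)) := ⟨_, rfl⟩
  -- The field `ξ + k (X - X(p))`: it equals `ξ` at `p` and has tangential derivative `k` times the
  -- projection.
  set Ξ : Fin (n + 1) → smoothOn (spaceTime n T) := fun b =>
    algebraMap ℝ _ (ξ b - k * X p b) + k • coord h.smooth b with hΞ
  have hΞp : ∀ b, smoothOn.eval p (Ξ b) = ξ b := by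
    intro b
    simp only [hΞ, map_add, map_smul, AlgHom.commutes, eval_coord, smul_eq_mul]
    simp
  have hDΞ : ∀ a b, h.D hT a (Ξ b) = k • h.D hT a (coord h.smooth b) := by
    intro a b
    simp only [hΞ, map_add, Derivation.map_algebraMap, Derivation.map_smul, zero_add]
  set G := pinch (h.D hT) (coord h.smooth_normal) Ξ ηf with hG
  have hGp : smoothOn.eval p G = 0 := by
    rw [hG, h.eval_pinch hT, heta]
    simp only [hΞp]
    exact hzero
  have hGmin : ∀ q : spaceTime n T, q.1.1 ≤ p.1.1 → smoothOn.eval p G ≤ smoothOn.eval q G := by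
    intro q hq
    rw [hGp, hG, h.eval_pinch hT, heta]
    exact hnonneg q hq _
  have hL : 0 ≤ smoothOn.eval p (∑ c, h.D hT c (h.D hT c G)) := by
    rw [map_sum]
    exact Finset.sum_nonneg fun c _ => h.eval_deriv_deriv_nonneg hT h0 hGmin c
  have ht := eval_deriv_time_nonpos (n := n) hT h0 hGmin
  have hev : ∀ b, ∑ a, smoothOn.eval p (h.D hT a (coord h.smooth_normal b)) *
      smoothOn.eval p (Ξ a) = smoothOn.eval p ηf * smoothOn.eval p
        (meanCurvature (h.D hT) (coord h.smooth_normal)) * smoothOn.eval p (Ξ b) := by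
    intro b
    simp only [hΞp, heta]
    exact h.eigenvector_of_pinchAt_eq_zero hT (hnonneg p le_rfl) hzero hξN b
  have hN0 : ∑ b, smoothOn.eval p (coord h.smooth_normal b) * smoothOn.eval p (Ξ b) = 0 := by
    simpa only [hΞp, eval_coord, ← inner_eq_sum] using hξN
  have hN1 : ∑ b, smoothOn.eval p (Ξ b) * smoothOn.eval p (Ξ b) = 1 := by
    simpa only [hΞp, ← inner_eq_sum] using hξ
  rw [hG, hS.eval_laplacian_pinch hDΞ hDη _ hN0 hN1 hev] at hL
  rw [hG, hF.eval_deriv_time_pinch _ hN0 hN1 hev] at ht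
  simp only [hΞp, heta, hDtη, h.eval_speed] at hL ht
  have hcard : ((Fintype.card (Fin (n + 1)) : ℕ) : ℝ) - 1 = n := by simp
  rw [hcard] at hL
  have ha := hS.eval_meanCurvature_sq_le (smoothOn.eval p)
  rw [hcard] at ha
  have hgs : g ^ 2 ≤ ∑ c, smoothOn.eval p (h.D hT c h.H) ^ 2 := by
    have := Finset.sum_mul_sq_le_sq_mul_sq Finset.univ
      (fun b => smoothOn.eval p (h.D hT b h.H)) (fun b => ξ b)
    have h1 : ∑ b, ξ b ^ 2 = 1 := by
      rw [← hξ, inner_eq_sum]; exact Finset.sum_congr rfl fun b _ => sq _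
    rw [h1, mul_one] at this
    exact this
  have hdpos : 0 < δ * Real.exp (C * p.1.1) := by positivity
  have hn' : (1 : ℝ) ≤ n := by exact_mod_cast hn
  exact contact_impossible (n := n) (h := H) (η := η) (d := δ * Real.exp (C * p.1.1)) (C := C)
    (s := ∑ c, smoothOn.eval p (h.D hT c h.H) ^ 2) (g := g) (f := H⁻¹)
    (a := smoothOn.eval p (normSq (h.D hT) (coord h.smooth_normal))) hn' hHpos
    (inv_mul_cancel₀ hHpos.ne') (by rw [hηdef]; nlinarith) hdpos hd (by rw [hηdef]; linarith) hgs ha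
    hC hk hL ht

end IsFlowFamily

namespace IsFlowFamily

open IsHypersurfaceFamily IsSurfaceFrame

variable {n : ℕ} {T : EReal} {X N : ℝ × Ambient n → Ambient n} {hT : 0 < T} {κ : ℝ}
  (h : IsFlowFamily n T X N hT κ)
include h

/-- Since `H` does not vanish, the left side divided by `H⁴` is continuous, hence bounded on a
compact set. The rate does not involve `δ`, so it survives the limit `δ → 0`. -/
lemma exists_growth_rate {K : Set (ℝ × Ambient n)} (hK : IsCompact K) (hKS : K ⊆ spaceTime n T) :
    ∃ C : ℝ, 0 < C ∧ ∀ p : spaceTime n T, p.1 ∈ K →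
      2 * (smoothOn.eval p (normSq (h.D hT) (coord h.smooth_normal)) * smoothOn.eval p h.H ^ 2
      + smoothOn.eval p h.H ^ 4)
      + 2 * (n + 1) * ∑ c, smoothOn.eval p (h.D hT c h.H) ^ 2 < C * smoothOn.eval p h.H ^ 4 := by
  set R : smoothOn (spaceTime n T) := 2 * (normSq (h.D hT) (coord h.smooth_normal) * h.H ^ 2
      + h.H ^ 4) + (2 * (n + 1) : ℝ) • ∑ c, h.D hT c h.H ^ 2 with hR
  have hc : ContinuousOn (smoothOn.ext (h.speed ^ 4 * R)) K :=
    (smoothOn.contDiffOn_ext _).continuousOn.mono hKS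
  obtain ⟨C, hC⟩ := hK.exists_bound_of_continuousOn hc
  refine ⟨|C| + 1, by positivity, fun p hp => ?_⟩
  have h1 := hC p hp
  have hpos : 0 < smoothOn.eval p h.H := h.meanCurvature_pos p
  rw [smoothOn.ext_apply, ← smoothOn.eval_apply, map_mul, map_pow, h.eval_speed,
    Real.norm_eq_abs] at h1
  have h2 : smoothOn.eval p R = 2 * (smoothOn.eval p (normSq (h.D hT) (coord h.smooth_normal))
      * smoothOn.eval p h.H ^ 2 + smoothOn.eval p h.H ^ 4)
      + 2 * (n + 1) * ∑ c, smoothOn.eval p (h.D hT c h.H) ^ 2 := by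
    simp only [hR, map_add, map_mul, map_smul, map_sum, map_pow, map_ofNat, smul_eq_mul]
  rw [← h2]
  have h3 : (smoothOn.eval p h.H)⁻¹ ^ 4 * smoothOn.eval p R < |C| + 1 := by
    linarith [le_abs_self ((smoothOn.eval p h.H)⁻¹ ^ 4 * smoothOn.eval p R), le_abs_self C]
  rw [inv_pow, inv_mul_lt_iff₀ (by positivity)] at h3
  linarith

/-- The pinching quantity, as a function on all of space. -/
noncomputable def pinchFun (η : ℝ → ℝ) (x : (ℝ × Ambient n) × Ambient n) : ℝ :=
  ∑ a, ∑ b, smoothOn.ext (h.D hT a (coord h.smooth_normal b)) x.1 * x.2 a * x.2 b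
    - η x.1.1 * (smoothOn.ext h.H x.1 * (⟪x.2, x.2⟫_ℝ - ⟪N x.1, x.2⟫_ℝ * ⟪N x.1, x.2⟫_ℝ))

lemma pinchFun_eq (η : ℝ → ℝ) (p : spaceTime n T) (ξ : Ambient n) :
    h.pinchFun η (p, ξ) = h.pinchAt hT p (η p.1.1) ξ := by
  simp only [pinchFun, pinchAt, smoothOn.ext_apply]
  rfl

lemma continuousOn_pinchFun {η : ℝ → ℝ} (hη : Continuous η) :
    ContinuousOn (h.pinchFun η) (spaceTime n T ×ˢ univ) := by
  have h1 : ∀ F : smoothOn (spaceTime n T), ContinuousOn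
      (fun x : (ℝ × Ambient n) × Ambient n => smoothOn.ext F x.1) (spaceTime n T ×ˢ univ) :=
    fun F => (smoothOn.contDiffOn_ext F).continuousOn.comp continuousOn_fst fun x hx => hx.1
  have h2 : ∀ a, Continuous (fun x : (ℝ × Ambient n) × Ambient n => x.2 a) := fun a => by fun_prop
  have h3 : ContinuousOn (fun x : (ℝ × Ambient n) × Ambient n => ⟪N x.1, x.2⟫_ℝ)
      (spaceTime n T ×ˢ univ) :=
    ContinuousOn.inner (h.smooth_normal.continuousOn.comp continuousOn_fst fun x hx => hx.1)
      continuousOn_snd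
  have h4 : ContinuousOn (fun x : (ℝ × Ambient n) × Ambient n => ⟪x.2, x.2⟫_ℝ)
      (spaceTime n T ×ˢ univ) := continuousOn_snd.inner continuousOn_snd
  have h5 : ContinuousOn (fun x : (ℝ × Ambient n) × Ambient n => η x.1.1)
      (spaceTime n T ×ˢ univ) := by fun_prop
  exact (continuousOn_finsetSum _ fun a _ => continuousOn_finsetSum _ fun b _ =>
    ((h1 _).mul (h2 a).continuousOn).mul (h2 b).continuousOn).sub
      (h5.mul ((h1 _).mul (h4.sub (h3.mul h3))))

/-- The perturbed pinching quantity stays positive. -/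
lemma pinchAt_pos (hn : 1 ≤ n) {ε δ C t₁ : ℝ} (hε0 : 0 ≤ ε) (hε1 : n * ε ≤ 1) (hδ : 0 < δ)
    (hrad : ∀ (p q : spaceTime n T) (r : ℝ), 0 < r → q.1.1 = p.1.1 → q.1.2 = r • p.1.2 →
      ∀ η ξ, 0 ≤ h.pinchAt hT q η ξ → 0 ≤ h.pinchAt hT p η ξ)
    (hinit : ∀ p : spaceTime n T, p.1.1 = 0 → ∀ ξ, 0 ≤ h.pinchAt hT p ε ξ)
    (ht₁ : t₁ ∈ timeInterval T) (hC0 : 0 < C) (hd : δ * Real.exp (C * t₁) ≤ 1)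
    (hC : ∀ p : spaceTime n T, p.1 ∈ Icc 0 t₁ ×ˢ Metric.sphere (0 : Ambient n) 1 →
      2 * (smoothOn.eval p (normSq (h.D hT) (coord h.smooth_normal)) * smoothOn.eval p h.H ^ 2
      + smoothOn.eval p h.H ^ 4)
      + 2 * (n + 1) * ∑ c, smoothOn.eval p (h.D hT c h.H) ^ 2 < C * smoothOn.eval p h.H ^ 4)
    (p : spaceTime n T) (hpt : p.1.1 = t₁) (ξ : Ambient n) :
    0 ≤ h.pinchAt hT p (ε - δ * Real.exp (C * t₁)) ξ := by
  set η : ℝ → ℝ := fun t => ε - δ * Real.exp (C * t) with hη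
  have hηc : Continuous η := by fun_prop
  have hmem : ∀ t ∈ Icc 0 t₁, t ∈ timeInterval T := fun t ht =>
    ⟨ht.1, lt_of_le_of_lt (EReal.coe_le_coe_iff.2 ht.2) ht₁.2⟩
  have hsph : Metric.sphere (0 : Ambient n) 1 ⊆ {0}ᶜ := fun z hz hz0 => by
    simp [show z = 0 from hz0] at hz
  set K : Set ((ℝ × Ambient n) × Ambient n) :=
    (Icc 0 t₁ ×ˢ Metric.sphere (0 : Ambient n) 1) ×ˢ Metric.sphere (0 : Ambient n) 1 with hK
  have hKc : IsCompact K := (isCompact_Icc.prod (isCompact_sphere _ _)).prod (isCompact_sphere _ _)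
  have hKS : K ⊆ spaceTime n T ×ˢ univ := fun x hx =>
    ⟨⟨hmem _ hx.1.1, hsph hx.1.2⟩, mem_univ _⟩
  have hQ : ContinuousOn (fun x : (ℝ × Ambient n) × Ambient n =>
      (⟪N x.1, x.2⟫_ℝ, h.pinchFun η x)) K := by
    refine ContinuousOn.prodMk (ContinuousOn.inner (h.smooth_normal.continuousOn.comp
      continuousOn_fst fun x hx => (hKS hx).1) continuousOn_snd) ?_
    exact (h.continuousOn_pinchFun hηc).mono hKS
  -- The unit tangent vectors, over the unit sphere and up to time `t₁`, on which the form is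
  -- nonpositive. This set is compact, so if it is nonempty there is an earliest contact time.
  set B := K ∩ (fun x : (ℝ × Ambient n) × Ambient n => (⟪N x.1, x.2⟫_ℝ, h.pinchFun η x)) ⁻¹'
    ({0} ×ˢ Iic 0) with hB
  have hBc : IsCompact B := hKc.of_isClosed_subset
    (hQ.preimage_isClosed_of_isClosed hKc.isClosed (isClosed_singleton.prod isClosed_Iic))
    inter_subset_left
  -- Before the earliest time in `B` the form is nonnegative: `hrad` reduces to base points on the
  -- unit sphere, homogeneity and invariance under adding normals to unit tangent vectors.
  have hgood : ∀ q : spaceTime n T, q.1.1 ≤ t₁ →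
      (∀ x ∈ B, q.1.1 < x.1.1) → ∀ ζ, 0 ≤ h.pinchAt hT q (η q.1.1) ζ := by
    intro q hq hqB ζ
    have hz : q.1.2 ≠ 0 := q.2.2
    have hz' : ‖q.1.2‖ ≠ 0 := norm_ne_zero_iff.2 hz
    set z : Ambient n := ‖q.1.2‖⁻¹ • q.1.2 with hzdef
    have hz1 : ‖z‖ = 1 := by rw [hzdef, norm_smul, norm_inv, norm_norm, inv_mul_cancel₀ hz']
    have hzs : z ∈ Metric.sphere (0 : Ambient n) 1 := by simpa using hz1
    set q' : spaceTime n T := ⟨(q.1.1, z), q.2.1, hsph hzs⟩ with hq'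
    refine hrad q q' ‖q.1.2‖⁻¹ (by positivity) rfl rfl _ _ ?_
    refine h.pinchAt_nonneg_of_unit hT q' _ (fun ξ hξ hξN => ?_) ζ
    by_contra! hneg
    refine (hqB (q'.1, ξ) ⟨⟨⟨⟨q.2.1.1, hq⟩, hzs⟩, by simpa using hξ⟩, hξN, ?_⟩).false
    change h.pinchFun η (q'.1, ξ) ≤ 0
    rw [h.pinchFun_eq]
    exact hneg.le
  rcases B.eq_empty_or_nonempty with hBe | hBne
  · have := hgood p hpt.le (by simp [hBe]) ξ
    rwa [hpt] at this
  exfalso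
  obtain ⟨x, hxB, hxmin⟩ := hBc.exists_isMinOn hBne
    (f := fun x : (ℝ × Ambient n) × Ambient n => x.1.1) (by fun_prop)
  have hxS := (hKS hxB.1).1
  set p₀ : spaceTime n T := ⟨x.1, hxS⟩ with hp₀
  have hξ1 : ‖x.2‖ = 1 := by simpa using hxB.1.2
  have hξξ : ⟪x.2, x.2⟫_ℝ = 1 := by rw [real_inner_self_eq_norm_sq, hξ1, one_pow]
  have hξN : ⟪N x.1, x.2⟫_ℝ = 0 := hxB.2.1
  have hle : h.pinchAt hT p₀ (η x.1.1) x.2 ≤ 0 := by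
    rw [← h.pinchFun_eq η p₀]
    exact hxB.2.2
  -- Contact cannot occur at time zero: there the perturbation makes the form strictly positive on
  -- unit tangent vectors.
  have ht0 : 0 < x.1.1 := by
    rcases hxS.1.1.lt_or_eq with h0 | h0
    · exact h0
    · exfalso
      have h1 := hinit p₀ h0.symm x.2
      have h2 := h.pinchAt_sub hT p₀ ε (δ * Real.exp (C * x.1.1)) x.2
      have h3 : 0 < smoothOn.eval p₀ (meanCurvature (h.D hT) (coord h.smooth_normal)) :=
        h.meanCurvature_pos p₀
      rw [hξN, hξξ] at h2
      have h4 : 0 < δ * Real.exp (C * x.1.1) *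
        (smoothOn.eval p₀ (meanCurvature (h.D hT) (coord h.smooth_normal)) * (1 - 0 * 0)) := by
        rw [zero_mul, sub_zero, mul_one]; positivity
      rw [hη] at hle
      linarith
  have hbefore : ∀ q : spaceTime n T, q.1.1 < x.1.1 → ∀ ζ, 0 ≤ h.pinchAt hT q (η q.1.1) ζ :=
    fun q hq ζ => hgood q (hq.le.trans hxB.1.1.1.2) (fun y hy => hq.trans_le (hxmin hy)) ζ
  -- At the contact time itself, nonnegativity follows by letting time increase to it.
  have hupto : ∀ q : spaceTime n T, q.1.1 ≤ x.1.1 → ∀ ζ, 0 ≤ h.pinchAt hT q (η q.1.1) ζ := by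
    intro q hq ζ
    rcases hq.lt_or_eq with hlt | heq
    · exact hbefore q hlt ζ
    have hI : timeInterval T ∈ 𝓝 x.1.1 :=
      mem_interior_iff_mem_nhds.1 (subset_interior_timeInterval T ⟨ht0, hxS.1.2⟩)
    have hc : ContinuousOn (fun s : ℝ => h.pinchFun η ((s, q.1.2), ζ)) (timeInterval T) :=
      (h.continuousOn_pinchFun hηc).comp (by fun_prop) fun s hs => ⟨⟨hs, q.2.2⟩, mem_univ _⟩
    have hlim := (hc.continuousAt hI).tendsto.mono_left (nhdsWithin_le_nhds (s := Iio x.1.1))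
    have h0 : 0 ≤ h.pinchFun η ((x.1.1, q.1.2), ζ) := by
      refine ge_of_tendsto hlim ?_
      filter_upwards [self_mem_nhdsWithin, nhdsWithin_le_nhds hI] with s hs hsI
      have := hbefore ⟨(s, q.1.2), hsI, q.2.2⟩ hs ζ
      rwa [← h.pinchFun_eq] at this
    rw [← h.pinchFun_eq]
    rw [← heq] at h0
    exact h0
  have hd' : δ * Real.exp (C * x.1.1) ≤ 1 := by
    refine le_trans (mul_le_mul_of_nonneg_left (Real.exp_le_exp.2 ?_) hδ.le) hd
    exact mul_le_mul_of_nonneg_left hxB.1.1.1.2 hC0.le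
  exact h.no_first_contact hn hε0 hε1 hδ (p := p₀) ht0 hξξ hξN hd' (hC p₀ hxB.1.1) hupto
    (le_antisymm hle (hupto p₀ le_rfl x.2))

/-- Pinching is preserved. -/
theorem pinchAt_nonneg (hn : 1 ≤ n) {ε : ℝ} (hε0 : 0 ≤ ε) (hε1 : n * ε ≤ 1)
    (hrad : ∀ (p q : spaceTime n T) (r : ℝ), 0 < r → q.1.1 = p.1.1 → q.1.2 = r • p.1.2 →
      ∀ η ξ, 0 ≤ h.pinchAt hT q η ξ → 0 ≤ h.pinchAt hT p η ξ)
    (hinit : ∀ p : spaceTime n T, p.1.1 = 0 → ∀ ξ, 0 ≤ h.pinchAt hT p ε ξ)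
    (p : spaceTime n T) (ξ : Ambient n) : 0 ≤ h.pinchAt hT p ε ξ := by
  have hK : IsCompact (Icc 0 p.1.1 ×ˢ Metric.sphere (0 : Ambient n) 1) :=
    isCompact_Icc.prod (isCompact_sphere _ _)
  obtain ⟨C, hC0, hC⟩ := h.exists_growth_rate hK fun q hq =>
    ⟨⟨hq.1.1, lt_of_le_of_lt (EReal.coe_le_coe_iff.2 hq.1.2) p.2.1.2⟩, fun hz0 => by
      have := hq.2
      simp [show q.2 = 0 from hz0] at this⟩
  -- With `δ = d exp(-Ct)` the perturbation at the final time `t` is exactly `d`; then `d` tends to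
  -- zero.
  have key : ∀ d ∈ Ioc (0 : ℝ) 1, 0 ≤ h.pinchAt hT p (ε - d) ξ := by
    intro d hd
    have := h.pinchAt_pos hn hε0 hε1 (δ := d * Real.exp (-(C * p.1.1)))
      (mul_pos hd.1 (Real.exp_pos _)) hrad hinit p.2.1 hC0 ?_ hC p rfl ξ
    · rwa [mul_assoc, ← Real.exp_add, neg_add_cancel, Real.exp_zero, mul_one] at this
    · rw [mul_assoc, ← Real.exp_add, neg_add_cancel, Real.exp_zero, mul_one]
      exact hd.2
  simp only [h.pinchAt_sub hT p ε] at key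
  set B := smoothOn.eval p (meanCurvature (h.D hT) (coord h.smooth_normal))
        * (⟪ξ, ξ⟫_ℝ - ⟪N p, ξ⟫_ℝ * ⟪N p, ξ⟫_ℝ)
  set A := h.pinchAt hT p ε ξ
  have hlim : Tendsto (fun d : ℝ => A + d * B) (𝓝[>] 0) (𝓝 (A + 0 * B)) := by
    refine Tendsto.mono_left ?_ nhdsWithin_le_nhds
    exact (Continuous.tendsto (by fun_prop) 0)
  rw [zero_mul, add_zero] at hlim
  refine ge_of_tendsto hlim ?_
  filter_upwards [Ioc_mem_nhdsGT (zero_lt_one' ℝ)] with d hd using key d hd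

end IsFlowFamily

/-! ### Radially constant extension from the sphere -/

lemma norm_inv_smul_mem_sphere {n : ℕ} {z : Ambient n} (hz : z ≠ 0) :
    ‖z‖⁻¹ • z ∈ Metric.sphere (0 : Ambient n) 1 := by
  rw [mem_sphere_zero_iff_norm, norm_smul, norm_inv, norm_norm,
    inv_mul_cancel₀ (norm_ne_zero_iff.2 hz)]

open Classical in
/-- The radial projection to the unit sphere. -/
noncomputable def sphereProj (n : ℕ) (z : Ambient n) : UnitSphere n :=
  if hz : z ≠ 0 then ⟨‖z‖⁻¹ • z, norm_inv_smul_mem_sphere hz⟩ else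
    ⟨EuclideanSpace.single 0 1, by simp⟩

lemma coe_sphereProj {n : ℕ} {z : Ambient n} (hz : z ≠ 0) :
    (sphereProj n z : Ambient n) = ‖z‖⁻¹ • z := by
  rw [sphereProj, dif_pos hz]

lemma sphereProj_coe {n : ℕ} (x : UnitSphere n) : sphereProj n x = x := by
  have hx : ‖(x : Ambient n)‖ = 1 := norm_eq_of_mem_sphere x
  have h0 : (x : Ambient n) ≠ 0 := norm_ne_zero_iff.1 (by rw [hx]; exact one_ne_zero)
  exact Subtype.ext (by rw [coe_sphereProj h0, hx, inv_one, one_smul])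

lemma sphereProj_smul {n : ℕ} {r : ℝ} (hr : 0 < r) (z : Ambient n) :
    sphereProj n (r • z) = sphereProj n z := by
  rcases eq_or_ne z 0 with rfl | hz
  · rw [smul_zero]
  refine Subtype.ext ?_
  rw [coe_sphereProj hz, coe_sphereProj (smul_ne_zero hr.ne' hz), norm_smul, smul_smul,
    Real.norm_of_nonneg hr.le, mul_inv_rev, mul_assoc, inv_mul_cancel₀ hr.ne', mul_one]

lemma contMDiffOn_sphereProj (n : ℕ) :
    ContMDiffOn 𝓘(ℝ, Ambient n) (𝓡 n) ∞ (sphereProj n) {0}ᶜ := by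
  have : Fact (Module.finrank ℝ (Ambient n) = n + 1) :=
    Fact.mk (@finrank_euclideanSpace_fin ℝ _ (n + 1))
  let U : TopologicalSpace.Opens (Ambient n) := ⟨{0}ᶜ, isOpen_compl_singleton⟩
  have h1 : ContMDiff 𝓘(ℝ, Ambient n) 𝓘(ℝ, Ambient n) ∞
      (fun z : U => ‖(z : Ambient n)‖⁻¹ • (z : Ambient n)) := by
    intro z
    have hz : (z : Ambient n) ≠ 0 := z.2
    refine (contMDiffAt_subtype_iff (U := U) (f := fun z : Ambient n => ‖z‖⁻¹ • z)).2 ?_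
    refine ContDiffAt.contMDiffAt ?_
    exact ((contDiffAt_norm ℝ hz).inv (norm_ne_zero_iff.2 hz)).smul contDiffAt_id
  have h2 := h1.codRestrict_sphere (n := n) (fun z => norm_inv_smul_mem_sphere z.2)
  intro z hz
  refine ContMDiffAt.contMDiffWithinAt ?_
  refine (contMDiffAt_subtype_iff (U := U) (x := ⟨z, hz⟩)).1 ?_
  have h3 : codRestrict _ _ (fun z : U => norm_inv_smul_mem_sphere z.2) =
      fun z : U => sphereProj n z := funext fun y => Subtype.ext (coe_sphereProj y.2).symm
  rw [h3] at h2
  exact h2 ⟨z, hz⟩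

/-- The radially constant extension of a family of maps on the sphere. -/
noncomputable def extendFamily {n : ℕ} (X : ℝ → UnitSphere n → Ambient n) (p : ℝ × Ambient n) :
    Ambient n := X p.1 (sphereProj n p.2)

lemma contDiffOn_extendFamily {n : ℕ} {T : EReal} {X : ℝ → UnitSphere n → Ambient n}
    (hX : ContMDiffOn (𝓘(ℝ, ℝ).prod (𝓡 n)) 𝓘(ℝ, Ambient n) ∞
      (fun p : ℝ × UnitSphere n => X p.1 p.2) (timeInterval T ×ˢ univ)) :
    ContDiffOn ℝ ∞ (extendFamily X) (spaceTime n T) := by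
  rw [← contMDiffOn_iff_contDiffOn, modelWithCornersSelf_prod, ← chartedSpaceSelf_prod]
  have h1 : ContMDiffOn (𝓘(ℝ, ℝ).prod 𝓘(ℝ, Ambient n)) (𝓘(ℝ, ℝ).prod (𝓡 n)) ∞
      (fun p : ℝ × Ambient n => (p.1, sphereProj n p.2)) (spaceTime n T) :=
    contMDiffOn_fst.prodMk ((contMDiffOn_sphereProj n).comp contMDiffOn_snd fun p hp => hp.2)
  exact hX.comp h1 fun p hp => ⟨hp.1, mem_univ _⟩

/-- The differential of the inclusion of the sphere. -/
noncomputable def sphereIncl (n : ℕ) (x : UnitSphere n) : TangentSpace (𝓡 n) x →L[ℝ] Ambient n :=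
  mvfderiv (𝓡 n) ((↑) : UnitSphere n → Ambient n) x

lemma exists_sphereIncl {n : ℕ} (x : UnitSphere n) (w : Ambient n) :
    ∃ v : TangentSpace (𝓡 n) x, w = sphereIncl n x v + ⟪(x : Ambient n), w⟫_ℝ • (x : Ambient n) := by
  have : Fact (Module.finrank ℝ (Ambient n) = n + 1) :=
    Fact.mk (@finrank_euclideanSpace_fin ℝ _ (n + 1))
  have h := range_mvfderiv_subtypeVal (n := n) x
  have h1 : w - ⟪(x : Ambient n), w⟫_ℝ • (x : Ambient n) ∈ (ℝ ∙ (x : Ambient n))ᗮ := by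
    rw [Submodule.mem_orthogonal_singleton_iff_inner_right, inner_sub_right, real_inner_smul_right,
      real_inner_self_eq_norm_sq, norm_eq_of_mem_sphere x]
    ring
  rw [← h] at h1
  obtain ⟨v, hv⟩ := h1
  exact ⟨v, eq_add_of_sub_eq hv.symm⟩

section Extension

variable {n : ℕ} {T : EReal} {X : ℝ → UnitSphere n → Ambient n}
  (hX : ContMDiffOn (𝓘(ℝ, ℝ).prod (𝓡 n)) 𝓘(ℝ, Ambient n) ∞
    (fun p : ℝ × UnitSphere n => X p.1 p.2) (timeInterval T ×ˢ univ))
include hX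

lemma hasFDerivAt_extendFamily_slice {t : ℝ} {z : Ambient n} (hp : (t, z) ∈ spaceTime n T) :
    HasFDerivAt (fun y => extendFamily X (t, y)) ((fderivWithin ℝ (extendFamily X) (spaceTime n T)
      (t, z)).comp (ContinuousLinearMap.inr ℝ ℝ (Ambient n))) z := by
  have h1 := ((contDiffOn_extendFamily hX).differentiableOn (by simp) _ hp).hasFDerivWithinAt
  have h2 : HasFDerivWithinAt (fun y : Ambient n => (t, y))
      (ContinuousLinearMap.inr ℝ ℝ (Ambient n)) {0}ᶜ z := (hasFDerivAt_prodMk_right t z).hasFDerivWithinAt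
  have h3 := h1.comp z h2 (fun y hy => ⟨hp.1, hy⟩)
  exact h3.hasFDerivAt (isOpen_compl_singleton.mem_nhds hp.2)

lemma fderivWithin_extendFamily_radial {t : ℝ} {z : Ambient n} (hp : (t, z) ∈ spaceTime n T) :
    fderivWithin ℝ (extendFamily X) (spaceTime n T) (t, z) (0, z) = 0 := by
  have h1 := hasFDerivAt_extendFamily_slice hX hp
  have h2 : HasDerivAt (fun s : ℝ => z + s • z) z 0 := hasDerivAt_line z z 0
  have h1' : HasFDerivAt (fun y => extendFamily X (t, y)) ((fderivWithin ℝ (extendFamily X)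
      (spaceTime n T) (t, z)).comp (ContinuousLinearMap.inr ℝ ℝ (Ambient n))) (z + (0 : ℝ) • z) := by
    simpa using h1
  have h3 := h1'.comp_hasDerivAt (0 : ℝ) h2
  have h4 : ((fun y => extendFamily X (t, y)) ∘ fun s : ℝ => z + s • z) =ᶠ[𝓝 0]
      fun _ => extendFamily X (t, z) := by
    filter_upwards [Ioi_mem_nhds (show (-1 : ℝ) < 0 by norm_num)] with s hs
    have hs : -1 < s := hs
    have : z + s • z = (1 + s) • z := by rw [add_smul, one_smul]
    simp only [Function.comp_apply, extendFamily, this]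
    rw [sphereProj_smul (by linarith)]
  exact h3.unique ((hasDerivAt_const _ _).congr_of_eventuallyEq h4)

/-- The extension is homogeneous of degree `0` in space, so its spatial derivative has degree `-1`.
-/
lemma fderivWithin_extendFamily_smul {t r : ℝ} (hr : 0 < r) {z : Ambient n}
    (hp : (t, z) ∈ spaceTime n T) (w : Ambient n) :
    fderivWithin ℝ (extendFamily X) (spaceTime n T) (t, z) (0, w) =
      r • fderivWithin ℝ (extendFamily X) (spaceTime n T) (t, r • z) (0, w) := by
  have hq : (t, r • z) ∈ spaceTime n T := ⟨hp.1, smul_ne_zero hr.ne' hp.2⟩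
  have h1 := hasFDerivAt_extendFamily_slice hX hp
  have h2 := hasFDerivAt_extendFamily_slice hX hq
  have h3 := h2.comp z ((hasFDerivAt_id z).const_smul r)
  have h4 : ((fun y => extendFamily X (t, y)) ∘ fun y : Ambient n => r • id y) =
      fun y => extendFamily X (t, y) := by
    funext y
    simp only [Function.comp_apply, extendFamily, id, sphereProj_smul hr]
  have h5 := congrArg (fun L => L w) ((h4 ▸ h3 : HasFDerivAt _ _ z).unique h1)
  simp only [ContinuousLinearMap.comp_apply, smul_apply,
    ContinuousLinearMap.id_apply, ContinuousLinearMap.inr_apply] at h5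
  rw [← h5, ← map_smul, Prod.smul_mk, smul_zero]

lemma mvfderiv_eq_extendFamily {t : ℝ} (ht : t ∈ timeInterval T) (x : UnitSphere n)
    (v : TangentSpace (𝓡 n) x) : mvfderiv (𝓡 n) (X t) x v =
      fderivWithin ℝ (extendFamily X) (spaceTime n T) (t, (x : Ambient n)) (0, sphereIncl n x v) := by
  have : Fact (Module.finrank ℝ (Ambient n) = n + 1) :=
    Fact.mk (@finrank_euclideanSpace_fin ℝ _ (n + 1))
  have h0 : (x : Ambient n) ≠ 0 := norm_ne_zero_iff.1 (by
    rw [norm_eq_of_mem_sphere x]; exact one_ne_zero)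
  have h1 := hasFDerivAt_extendFamily_slice hX (t := t) (z := (x : Ambient n)) ⟨ht, h0⟩
  have h2 : X t = (fun y => extendFamily X (t, y)) ∘ ((↑) : UnitSphere n → Ambient n) := by
    funext y
    simp only [Function.comp_apply, extendFamily, sphereProj_coe]
  have h3 : MDifferentiableAt (𝓡 n) 𝓘(ℝ, Ambient n) ((↑) : UnitSphere n → Ambient n) x :=
    (contMDiff_coe_sphere (m := 1) x).mdifferentiableAt one_ne_zero
  have h4 : mfderiv 𝓘(ℝ, Ambient n) 𝓘(ℝ, Ambient n) (fun y => extendFamily X (t, y))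
      (x : Ambient n) = (fderivWithin ℝ (extendFamily X) (spaceTime n T)
        (t, (x : Ambient n))).comp (ContinuousLinearMap.inr ℝ ℝ (Ambient n)) := by
    rw [mfderiv_eq_fderiv, ← h1.fderiv]
  have h5 := mfderiv_comp_apply (I := 𝓡 n) (I' := 𝓘(ℝ, Ambient n)) (I'' := 𝓘(ℝ, Ambient n))
    (g := fun y : Ambient n => extendFamily X (t, y)) (f := ((↑) : UnitSphere n → Ambient n)) x
    h1.differentiableAt.mdifferentiableAt h3 v
  rw [h4, ← h2] at h5
  exact h5

lemma fderivWithin_extendFamily_time {t : ℝ} {z : Ambient n} (hp : (t, z) ∈ spaceTime n T)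
    (hT : 0 < T) {X' : Ambient n}
    (h : HasDerivWithinAt (fun s => X s (sphereProj n z)) X' (timeInterval T) t) :
    fderivWithin ℝ (extendFamily X) (spaceTime n T) (t, z) (1, 0) = X' := by
  have h1 := ((contDiffOn_extendFamily hX).differentiableOn (by simp) _ hp).hasFDerivWithinAt
  have h2 : HasDerivWithinAt (fun s : ℝ => (s, z)) ((1 : ℝ), (0 : Ambient n)) (timeInterval T) t :=
    ((hasDerivAt_id t).prodMk (hasDerivAt_const t z)).hasDerivWithinAt
  have h3 := h1.comp_hasDerivWithinAt t h2
    (show MapsTo (fun s : ℝ => (s, z)) (timeInterval T) (spaceTime n T) from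
      fun s hs => ⟨hs, hp.2⟩)
  exact (uniqueDiffOn_convex (convex_timeInterval T)
    (nonempty_interior_timeInterval hT) t hp.1).eq_deriv _ h3 h

end Extension

/-! ### Comparison with the second fundamental form and mean curvature on the sphere -/

open Matrix in
/-- The trace of an operator vanishing on the unit vector `N`, in terms of its Gram-type matrices
with respect to a frame (the rows of `Y`) of the orthogonal complement of `N`. -/
lemma trace_gram_inv_mul {n m : ℕ} (Y : Matrix (Fin n) (Fin m) ℝ) (N : Fin m → ℝ)
    (W : Matrix (Fin m) (Fin m) ℝ) (hY : Function.Injective fun c => c ᵥ* Y) (hN : Y *ᵥ N = 0)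
    (hNN : N ⬝ᵥ N = 1) (hspan : ∀ v, ∃ (c : Fin n → ℝ) (s : ℝ), v = c ᵥ* Y + s • N)
    (hW : N ᵥ* W = 0) : ((Y * Yᵀ)⁻¹ * (Y * W * Yᵀ)).trace = W.trace := by
  have hunit : IsUnit (Y * Yᵀ) := by
    rw [← mulVec_injective_iff_isUnit]
    have hker : ∀ c, (Y * Yᵀ) *ᵥ c = 0 → c = 0 := by
      intro c hc
      have h1 : (c ᵥ* Y) ⬝ᵥ (c ᵥ* Y) = 0 := by
        rw [← dotProduct_mulVec, ← mulVec_transpose, mulVec_mulVec, hc, dotProduct_zero]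
      have h2 : c ᵥ* Y = (0 : Fin n → ℝ) ᵥ* Y := by
        rw [dotProduct_self_eq_zero.1 h1, zero_vecMul]
      exact hY h2
    intro a b hab
    have := hker (a - b) (by rw [mulVec_sub]; exact sub_eq_zero.2 hab)
    exact sub_eq_zero.1 this
  have hdet : IsUnit (Y * Yᵀ).det := (isUnit_iff_isUnit_det _).1 hunit
  -- The first summand is the orthogonal projection onto the row space of `Y`, which together with
  -- `N` spans everything. After cycling the trace only this projection acts on `W`, and `N`
  -- contributes nothing.
  have hP : Yᵀ * (Y * Yᵀ)⁻¹ * Y + vecMulVec N N = 1 := by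
    refine ext_of_mulVec_single fun i => ?_
    rw [one_mulVec]
    obtain ⟨c, s, hv⟩ := hspan (Pi.single i 1)
    rw [hv, ← mulVec_transpose, mulVec_add, mulVec_smul, add_mulVec, add_mulVec, mulVec_mulVec,
      mulVec_mulVec, Matrix.mul_assoc, Matrix.mul_assoc, nonsing_inv_mul _ hdet, Matrix.mul_one]
    rw [← mulVec_mulVec N, hN, mulVec_zero, zero_add]
    have h1 : vecMulVec N N *ᵥ N = N := by
      rw [vecMulVec_mulVec]; simp [hNN]
    have h2 : vecMulVec N N * Yᵀ = 0 := by
      rw [vecMulVec_mul, vecMul_transpose, hN]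
      exact ext fun _ _ => mul_zero _
    rw [h1, h2, zero_mulVec, add_zero]
  calc ((Y * Yᵀ)⁻¹ * (Y * W * Yᵀ)).trace = (Yᵀ * (Y * Yᵀ)⁻¹ * Y * W).trace := by
        rw [← Matrix.mul_assoc, trace_mul_comm]
        simp only [Matrix.mul_assoc]
    _ = ((1 - vecMulVec N N) * W).trace := by rw [← hP, add_sub_cancel_right]
    _ = W.trace := by
        rw [Matrix.sub_mul, Matrix.one_mul, vecMulVec_mul, hW]; simp

/-- A smooth family of immersions of the sphere with a smooth family of unit normal fields. -/
structure IsImmersedFamily (n : ℕ) (T : EReal) (X ν : ℝ → UnitSphere n → Ambient n) : Prop where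
  smooth : ContMDiffOn (𝓘(ℝ, ℝ).prod (𝓡 n)) 𝓘(ℝ, Ambient n) ∞
    (fun p : ℝ × UnitSphere n => X p.1 p.2) (timeInterval T ×ˢ univ)
  smooth_normal : ContMDiffOn (𝓘(ℝ, ℝ).prod (𝓡 n)) 𝓘(ℝ, Ambient n) ∞
    (fun p : ℝ × UnitSphere n => ν p.1 p.2) (timeInterval T ×ˢ univ)
  immersion : ∀ t ∈ timeInterval T, ∀ x, Function.Injective (mvfderiv (𝓡 n) (X t) x)
  norm_normal : ∀ t ∈ timeInterval T, ∀ x, ‖ν t x‖ = 1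
  normal : ∀ t ∈ timeInterval T, ∀ x, ∀ v : TangentSpace (𝓡 n) x,
    ⟪mvfderiv (𝓡 n) (X t) x v, ν t x⟫_ℝ = 0

namespace IsImmersedFamily

open IsHypersurfaceFamily

variable {n : ℕ} {T : EReal} {X ν : ℝ → UnitSphere n → Ambient n} (h : IsImmersedFamily n T X ν)
include h

omit h in
lemma coe_ne_zero (x : UnitSphere n) : (x : Ambient n) ≠ 0 :=
  norm_ne_zero_iff.1 (by rw [norm_eq_of_mem_sphere x]; exact one_ne_zero)

omit h in
lemma eq_smul_sphereProj {z : Ambient n} (hz : z ≠ 0) : z = ‖z‖ • (sphereProj n z : Ambient n) := by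
  rw [coe_sphereProj hz, smul_smul, mul_inv_cancel₀ (norm_ne_zero_iff.2 hz), one_smul]

omit h in
/-- The derivative at an arbitrary point, expressed through the derivative on the sphere. -/
lemma fderivWithin_eq_mvfderiv {Y : ℝ → UnitSphere n → Ambient n}
    (hY : ContMDiffOn (𝓘(ℝ, ℝ).prod (𝓡 n)) 𝓘(ℝ, Ambient n) ∞
      (fun p : ℝ × UnitSphere n => Y p.1 p.2) (timeInterval T ×ˢ univ)) {p : ℝ × Ambient n}
    (hp : p ∈ spaceTime n T) (v : TangentSpace (𝓡 n) (sphereProj n p.2)) (s : ℝ) :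
    fderivWithin ℝ (extendFamily Y) (spaceTime n T) p (0, sphereIncl n _ v + s • p.2) =
      ‖p.2‖⁻¹ • mvfderiv (𝓡 n) (Y p.1) (sphereProj n p.2) v := by
  obtain ⟨t, z⟩ := p
  have hz : z ≠ 0 := hp.2
  have h1 : ((0 : ℝ), sphereIncl n _ v + s • z) = (0, sphereIncl n (sphereProj n z) v)
      + s • ((0 : ℝ), z) := by simp
  rw [h1, map_add, map_smul, fderivWithin_extendFamily_radial hY hp, smul_zero, add_zero,
    mvfderiv_eq_extendFamily hY hp.1, coe_sphereProj hz,
    fderivWithin_extendFamily_smul hY (inv_pos.2 (norm_pos_iff.2 hz)) hp]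

omit h in
lemma exists_decomp {z : Ambient n} (hz : z ≠ 0) (w : Ambient n) :
    ∃ (v : TangentSpace (𝓡 n) (sphereProj n z)) (s : ℝ), w = sphereIncl n _ v + s • z ∧
      ⟪z, w⟫_ℝ = s * ‖z‖ ^ 2 := by
  obtain ⟨v, hv⟩ := exists_sphereIncl (sphereProj n z) w
  have h1 := eq_smul_sphereProj hz
  have h2 : ⟪z, w⟫_ℝ = ‖z‖ * ⟪(sphereProj n z : Ambient n), w⟫_ℝ := by
    conv_lhs => rw [h1]
    rw [real_inner_smul_left]
  have hz' := norm_ne_zero_iff.2 hz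
  refine ⟨v, ⟪(sphereProj n z : Ambient n), w⟫_ℝ * ‖z‖⁻¹, ?_, ?_⟩
  · rw [mul_smul, ← coe_sphereProj hz]; exact hv
  · rw [h2]; field_simp

lemma isHypersurfaceFamily : IsHypersurfaceFamily n T (extendFamily X) (extendFamily ν) where
  smooth := contDiffOn_extendFamily h.smooth
  smooth_normal := contDiffOn_extendFamily h.smooth_normal
  norm p hp := h.norm_normal p.1 hp.1 _
  normal p hp w := by
    obtain ⟨v, s, hw, -⟩ := exists_decomp hp.2 w
    rw [hw, fderivWithin_eq_mvfderiv h.smooth hp, real_inner_smul_left]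
    have := h.normal p.1 hp.1 _ v
    rw [extendFamily, this, mul_zero]
  injective p hp w hw hpw := by
    obtain ⟨v, s, hv, hs⟩ := exists_decomp hp.2 w
    have hz' := norm_ne_zero_iff.2 hp.2
    rw [hpw, zero_eq_mul] at hs
    have hs0 : s = 0 := hs.resolve_right (pow_ne_zero 2 hz')
    rw [hv, fderivWithin_eq_mvfderiv h.smooth hp] at hw
    have h1 := (smul_eq_zero.1 hw).resolve_left (inv_ne_zero hz')
    have h2 : v = 0 := h.immersion p.1 hp.1 _ (by rw [h1, map_zero])
    rw [hv, h2, hs0]; simp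

/-- The shape operator at a point of space-time, as an operator on the ambient space. -/
noncomputable def shapeOp (_h : IsImmersedFamily n T X ν) (p : ℝ × Ambient n) :
    Ambient n →L[ℝ] Ambient n :=
  ((fderivWithin ℝ (extendFamily ν) (spaceTime n T) p).comp
    (ContinuousLinearMap.inr ℝ ℝ (Ambient n))).comp
    (frameMap T (extendFamily X) (extendFamily ν) p).inverse

/-- The extension of `X` has no radial derivative, so the completed frame sends `p.2` to `‖p.2‖²`
times the normal. -/
lemma inverse_frameMap_normal {p : ℝ × Ambient n} (hp : p ∈ spaceTime n T) :
    (frameMap T (extendFamily X) (extendFamily ν) p).inverse (extendFamily ν p) =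
      (‖p.2‖ ^ 2)⁻¹ • p.2 := by
  have hz' := norm_ne_zero_iff.2 hp.2
  have h1 : frameMap T (extendFamily X) (extendFamily ν) p ((‖p.2‖ ^ 2)⁻¹ • p.2) =
      extendFamily ν p := by
    rw [map_smul, frameMap_apply, fderivWithin_extendFamily_radial (t := p.1) h.smooth hp, zero_add,
      smul_smul, real_inner_self_eq_norm_sq, inv_mul_cancel₀ (pow_ne_zero 2 hz'), one_smul]
  conv_lhs => rw [← h1]
  rw [h.isHypersurfaceFamily.inverse_frameMap hp]

lemma shapeOp_normal {p : ℝ × Ambient n} (hp : p ∈ spaceTime n T) :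
    h.shapeOp p (extendFamily ν p) = 0 := by
  rw [shapeOp, ContinuousLinearMap.comp_apply, h.inverse_frameMap_normal hp, map_smul]
  have := fderivWithin_extendFamily_radial (t := p.1) h.smooth_normal hp
  simp only [ContinuousLinearMap.comp_apply, ContinuousLinearMap.inr_apply]
  rw [this, smul_zero]

lemma shapeOp_apply_fderivWithin {p : ℝ × Ambient n} (hp : p ∈ spaceTime n T) (w : Ambient n) :
    h.shapeOp p (fderivWithin ℝ (extendFamily X) (spaceTime n T) p (0, w)) =
      fderivWithin ℝ (extendFamily ν) (spaceTime n T) p (0, w) := by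
  have h1 : fderivWithin ℝ (extendFamily X) (spaceTime n T) p (0, w) =
      frameMap T (extendFamily X) (extendFamily ν) p w - ⟪p.2, w⟫_ℝ • extendFamily ν p := by
    rw [frameMap_apply, add_sub_cancel_right]
  rw [h1, map_sub, map_smul, h.shapeOp_normal hp, smul_zero, sub_zero, shapeOp,
    ContinuousLinearMap.comp_apply, h.isHypersurfaceFamily.inverse_frameMap hp]
  rfl

lemma shapeOp_mvfderiv {p : ℝ × Ambient n} (hp : p ∈ spaceTime n T)
    (v : TangentSpace (𝓡 n) (sphereProj n p.2)) :
    h.shapeOp p (mvfderiv (𝓡 n) (X p.1) (sphereProj n p.2) v) =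
      mvfderiv (𝓡 n) (ν p.1) (sphereProj n p.2) v := by
  have hz' := norm_ne_zero_iff.2 hp.2
  have h1 := h.shapeOp_apply_fderivWithin hp (sphereIncl n _ v + (0 : ℝ) • p.2)
  rw [fderivWithin_eq_mvfderiv h.smooth hp, fderivWithin_eq_mvfderiv h.smooth_normal hp,
    map_smul] at h1
  exact smul_right_injective _ (inv_ne_zero hz') h1

lemma exists_eq_mvfderiv_add {p : ℝ × Ambient n} (hp : p ∈ spaceTime n T) (ξ : Ambient n) :
    ∃ (v : TangentSpace (𝓡 n) (sphereProj n p.2)) (s : ℝ),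
      ξ = mvfderiv (𝓡 n) (X p.1) (sphereProj n p.2) v + s • extendFamily ν p := by
  obtain ⟨v, s, hv, -⟩ := exists_decomp hp.2
    ((frameMap T (extendFamily X) (extendFamily ν) p).inverse ξ)
  refine ⟨‖p.2‖⁻¹ • v, ⟪p.2, (frameMap T (extendFamily X) (extendFamily ν) p).inverse ξ⟫_ℝ, ?_⟩
  rw [map_smul, ← fderivWithin_eq_mvfderiv h.smooth hp v s, ← hv, ← frameMap_apply,
    h.isHypersurfaceFamily.frameMap_inverse hp]

/-- Along a ray the derivatives of `X` and of `ν` scale by the same factor, so the operator taking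
the first to the second does not change. This gives the hypothesis `hrad` of the maximum principle.
-/
lemma shapeOp_eq_of_smul {p q : ℝ × Ambient n} (hp : p ∈ spaceTime n T) (hq : q ∈ spaceTime n T)
    {r : ℝ} (hr : 0 < r) (h1 : q.1 = p.1) (h2 : q.2 = r • p.2) : h.shapeOp q = h.shapeOp p := by
  obtain ⟨t, z⟩ := p
  obtain ⟨t', z'⟩ := q
  obtain rfl : t' = t := h1
  obtain rfl : z' = r • z := h2
  have hν : extendFamily ν (t', r • z) = extendFamily ν (t', z) := by
    simp only [extendFamily, sphereProj_smul hr]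
  ext ξ : 1
  have h3 : ∃ (w : Ambient n) (s : ℝ), ξ = fderivWithin ℝ (extendFamily X) (spaceTime n T) (t', z)
      (0, w) + s • extendFamily ν (t', z) :=
    ⟨_, _, by rw [← frameMap_apply, h.isHypersurfaceFamily.frameMap_inverse hp]⟩
  obtain ⟨w, s, rfl⟩ := h3
  rw [map_add, map_add, map_smul, map_smul, h.shapeOp_normal hp, ← hν, h.shapeOp_normal hq,
    h.shapeOp_apply_fderivWithin hp, fderivWithin_extendFamily_smul h.smooth hr hp, map_smul,
    h.shapeOp_apply_fderivWithin hq, ← fderivWithin_extendFamily_smul h.smooth_normal hr hp]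

variable (hT : 0 < T)

lemma eval_D_normal (p : spaceTime n T) (a b : Fin (n + 1)) :
    smoothOn.eval p (h.isHypersurfaceFamily.D hT a (coord h.isHypersurfaceFamily.smooth_normal b)) =
      h.shapeOp p (EuclideanSpace.single a 1) b := by
  rw [D, smoothOn.eval_dirDeriv, fderivWithin_coord hT _ _ p.2]
  rfl

lemma sum_shapeOp (p : ℝ × Ambient n) (ξ : Ambient n) :
    h.shapeOp p ξ = ∑ a, ξ a • h.shapeOp p (EuclideanSpace.single a 1) := by
  have : ξ = ∑ a, ξ a • (EuclideanSpace.single a 1 : Ambient n) := by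
    ext i
    simp [Pi.single_apply]
  conv_lhs => rw [this]
  simp only [map_sum, map_smul]

/-- With the coordinate tangent vectors as rows of `Y`, the metric is `Y Yᵀ` and the second
fundamental form is `Y W Yᵀ`, so `trace_gram_inv_mul` identifies the coordinate trace with the
ambient one. -/
lemma eval_meanCurvature (p : spaceTime n T) : smoothOn.eval p
    (IsSurfaceFrame.meanCurvature (h.isHypersurfaceFamily.D hT)
      (coord h.isHypersurfaceFamily.smooth_normal)) =
    meanCurv (X p.1.1) (ν p.1.1) (sphereProj n p.1.2) := by
  set x := sphereProj n p.1.2 with hx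
  set y : Fin n → Ambient n := fun i => mvfderiv (𝓡 n) (X p.1.1) x (coordVec n x i) with hy
  set Y : Matrix (Fin n) (Fin (n + 1)) ℝ := Matrix.of fun i a => y i a with hY
  set W : Matrix (Fin (n + 1)) (Fin (n + 1)) ℝ :=
    Matrix.of fun a b => h.shapeOp p (EuclideanSpace.single a 1) b with hW
  have hvec : ∀ c : Fin n → ℝ, ∀ a, (Matrix.vecMul c Y) a =
      mvfderiv (𝓡 n) (X p.1.1) x (WithLp.toLp 2 c : EuclideanSpace ℝ (Fin n)) a := by
    intro c a
    have h1 : (WithLp.toLp 2 c : EuclideanSpace ℝ (Fin n)) =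
        ∑ i, c i • (EuclideanSpace.single i 1 : EuclideanSpace ℝ (Fin n)) := by
      ext j; simp [Pi.single_apply]
    have h2 : mvfderiv (𝓡 n) (X p.1.1) x (WithLp.toLp 2 c : EuclideanSpace ℝ (Fin n)) =
        ∑ i, c i • y i := by
      rw [h1]
      exact (map_sum (mvfderiv (𝓡 n) (X p.1.1) x) _ _).trans
        (Finset.sum_congr rfl fun i _ => map_smul _ _ _)
    rw [h2]
    simp [Matrix.vecMul, dotProduct, hY]
  have hg : metricMatrix (X p.1.1) x = Y * Y.transpose := by
    ext i j
    simp only [metricMatrix, inducedMetric, Matrix.of_apply, Matrix.mul_apply, Matrix.transpose_apply,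
      inner_eq_sum, hY, hy]
  have hh : secondFundMatrix (X p.1.1) (ν p.1.1) x = Y * W * Y.transpose := by
    ext i j
    simp only [secondFundMatrix, secondFundForm, Matrix.of_apply]
    rw [← h.shapeOp_mvfderiv p.2, h.sum_shapeOp, inner_eq_sum]
    simp only [Matrix.mul_apply, Matrix.transpose_apply, hY, hW, Matrix.of_apply, hy]
    refine Finset.sum_congr rfl fun b _ => ?_
    simp only [WithLp.ofLp_sum, Finset.sum_apply, PiLp.smul_apply, smul_eq_mul]
    rfl
  rw [meanCurv, hg, hh, trace_gram_inv_mul Y (fun a => extendFamily ν p a) W]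
  · simp only [IsSurfaceFrame.meanCurvature, map_sum, h.eval_D_normal hT, Matrix.trace,
      Matrix.diag_apply, hW, Matrix.of_apply]
  · intro c d hcd
    have h1 : mvfderiv (𝓡 n) (X p.1.1) x (WithLp.toLp 2 c : EuclideanSpace ℝ (Fin n)) =
        mvfderiv (𝓡 n) (X p.1.1) x (WithLp.toLp 2 d : EuclideanSpace ℝ (Fin n)) := by
      ext a
      rw [← hvec, ← hvec]
      exact congrFun hcd a
    exact (WithLp.toLp_injective 2) (h.immersion _ p.2.1 x h1)
  · ext i
    have := h.normal _ p.2.1 x (coordVec n x i)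
    rw [inner_eq_sum] at this
    exact this
  · have := h.isHypersurfaceFamily.inner_normal_self p
    rwa [inner_eq_sum] at this
  · intro u
    obtain ⟨v, s, hv⟩ := h.exists_eq_mvfderiv_add p.2 (WithLp.toLp 2 u)
    let c : EuclideanSpace ℝ (Fin n) := v
    refine ⟨fun i => c i, s, ?_⟩
    funext a
    have := congrArg (fun ξ : Ambient n => ξ a) hv
    rw [Pi.add_apply, hvec]
    exact this
  · funext b
    have := congrArg (fun ξ : Ambient n => ξ b) (h.shapeOp_normal p.2)
    simp only [h.sum_shapeOp _ (extendFamily ν p)] at this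
    simpa [Matrix.vecMul, dotProduct, hW] using this

lemma pinchAt_mvfderiv (p : spaceTime n T) (η : ℝ)
    (v : TangentSpace (𝓡 n) (sphereProj n p.1.2)) :
    h.isHypersurfaceFamily.pinchAt hT p η (mvfderiv (𝓡 n) (X p.1.1) (sphereProj n p.1.2) v) =
      secondFundForm (X p.1.1) (ν p.1.1) (sphereProj n p.1.2) v v
      - η * meanCurv (X p.1.1) (ν p.1.1) (sphereProj n p.1.2)
        * inducedMetric (X p.1.1) (sphereProj n p.1.2) v v := by
  have h1 : ⟪extendFamily ν p, mvfderiv (𝓡 n) (X p.1.1) (sphereProj n p.1.2) v⟫_ℝ = 0 := by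
    rw [real_inner_comm]; exact h.normal _ p.2.1 _ v
  rw [pinchAt, h1, h.eval_meanCurvature hT, secondFundForm, ← h.shapeOp_mvfderiv p.2,
    h.sum_shapeOp, inner_eq_sum (n := n) (∑ a, _)]
  simp only [h.eval_D_normal hT, inducedMetric]
  rw [Finset.sum_comm]
  have h2 : ∀ b, (∑ a, mvfderiv (𝓡 n) (X p.1.1) (sphereProj n p.1.2) v a •
      h.shapeOp p (EuclideanSpace.single a 1)) b * mvfderiv (𝓡 n) (X p.1.1) (sphereProj n p.1.2) v b
      = ∑ a, h.shapeOp p (EuclideanSpace.single a 1) b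
        * mvfderiv (𝓡 n) (X p.1.1) (sphereProj n p.1.2) v a
        * mvfderiv (𝓡 n) (X p.1.1) (sphereProj n p.1.2) v b := by
    intro b
    simp only [WithLp.ofLp_sum, Finset.sum_apply, PiLp.smul_apply, smul_eq_mul, Finset.sum_mul]
    exact Finset.sum_congr rfl fun a _ => by ring
  simp only [h2]
  ring

lemma pinchAt_nonneg_iff (p : spaceTime n T) (η : ℝ) :
    (∀ ξ, 0 ≤ h.isHypersurfaceFamily.pinchAt hT p η ξ) ↔
      ∀ v : TangentSpace (𝓡 n) (sphereProj n p.1.2),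
        η * meanCurv (X p.1.1) (ν p.1.1) (sphereProj n p.1.2)
        * inducedMetric (X p.1.1) (sphereProj n p.1.2) v v ≤
          secondFundForm (X p.1.1) (ν p.1.1) (sphereProj n p.1.2) v v := by
  constructor
  · intro hp v
    have := hp (mvfderiv (𝓡 n) (X p.1.1) (sphereProj n p.1.2) v)
    rw [h.pinchAt_mvfderiv hT] at this
    linarith
  · intro hp ξ
    obtain ⟨v, s, rfl⟩ := h.exists_eq_mvfderiv_add p.2 ξ
    rw [h.isHypersurfaceFamily.pinchAt_add_normal, h.pinchAt_mvfderiv hT]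
    linarith [hp v]

lemma pinchAt_eq_of_smul (p q : spaceTime n T) {r : ℝ} (hr : 0 < r) (h1 : q.1.1 = p.1.1)
    (h2 : q.1.2 = r • p.1.2) (η : ℝ) (ξ : Ambient n) :
    h.isHypersurfaceFamily.pinchAt hT q η ξ = h.isHypersurfaceFamily.pinchAt hT p η ξ := by
  have h3 : extendFamily ν q = extendFamily ν p := by
    simp only [extendFamily, h1, h2, sphereProj_smul hr]
  simp only [pinchAt, h.eval_D_normal hT, h.eval_meanCurvature hT,
    h.shapeOp_eq_of_smul p.2 q.2 hr h1 h2, h3, h1, h2, sphereProj_smul hr]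

end IsImmersedFamily

/-! ### Optimal pinching and the sign of the mean curvature -/

namespace IsHypersurfaceFamily

variable {n : ℕ} {T : EReal} {X N : ℝ × Ambient n → Ambient n} (h : IsHypersurfaceFamily n T X N)
include h

/-- The matrix of the quadratic form `pinchAt`. -/
noncomputable def pinchMatrix (hT : 0 < T) (p : spaceTime n T) (η : ℝ) :
    Matrix (Fin (n + 1)) (Fin (n + 1)) ℝ :=
  (Matrix.of fun a b => smoothOn.eval p (h.D hT a (coord h.smooth_normal b)))
    - (η * smoothOn.eval p (IsSurfaceFrame.meanCurvature (h.D hT) (coord h.smooth_normal))) •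
      (1 - Matrix.vecMulVec (N p) (N p))

lemma pinchAt_eq_dotProduct (hT : 0 < T) (p : spaceTime n T) (η : ℝ) (ξ : Ambient n) :
    h.pinchAt hT p η ξ = ξ.ofLp ⬝ᵥ (h.pinchMatrix hT p η).mulVec ξ.ofLp := by
  have h1 : ∀ M : Matrix (Fin (n + 1)) (Fin (n + 1)) ℝ, ξ.ofLp ⬝ᵥ M.mulVec ξ.ofLp =
      ∑ a, ∑ b, M a b * ξ a * ξ b := by
    intro M
    simp only [Matrix.mulVec, dotProduct, Finset.mul_sum]
    exact Finset.sum_congr rfl fun a _ => Finset.sum_congr rfl fun b _ => by ring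
  rw [pinchMatrix, Matrix.sub_mulVec, dotProduct_sub, h1 (Matrix.of _), Matrix.smul_mulVec,
    dotProduct_smul, Matrix.sub_mulVec, dotProduct_sub, Matrix.one_mulVec, Matrix.vecMulVec_mulVec,
    pinchAt, inner_eq_sum, inner_eq_sum]
  simp only [Matrix.of_apply, smul_eq_mul, mul_assoc, dotProduct_smul, op_smul_eq_smul]
  rw [dotProduct_comm ξ.ofLp (N p).ofLp]
  rfl

lemma trace_pinchMatrix (hT : 0 < T) (p : spaceTime n T) (η : ℝ) :
    (h.pinchMatrix hT p η).trace = (1 - n * η) *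
      smoothOn.eval p (IsSurfaceFrame.meanCurvature (h.D hT) (coord h.smooth_normal)) := by
  have h1 : (N p).ofLp ⬝ᵥ (N p).ofLp = 1 := by
    have := h.inner_normal_self p
    rwa [inner_eq_sum] at this
  rw [pinchMatrix, Matrix.trace_sub, Matrix.trace_smul, Matrix.trace_sub, Matrix.trace_one,
    Matrix.trace_vecMulVec, h1, IsSurfaceFrame.meanCurvature, map_sum]
  simp only [Matrix.trace, Matrix.diag_apply, Matrix.of_apply, Fintype.card_fin, smul_eq_mul]
  push_cast
  ring

lemma posSemidef_pinchMatrix (hT : 0 < T) (p : spaceTime n T) (η : ℝ)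
    (hp : ∀ ξ, 0 ≤ h.pinchAt hT p η ξ) : (h.pinchMatrix hT p η).PosSemidef := by
  refine .of_dotProduct_mulVec_nonneg (Matrix.IsHermitian.ext fun a b => ?_) fun x => ?_
  · simp only [pinchMatrix, Matrix.sub_apply, Matrix.of_apply, Matrix.smul_apply,
      Matrix.vecMulVec_apply, star_trivial, (h.isSurfaceFrame hT).shape_symm a b,
      mul_comm (N p a), Matrix.one_apply, eq_comm (a := a)]
  · have := hp (WithLp.toLp 2 x)
    rwa [pinchAt_eq_dotProduct] at this

/-- A hypersurface pinched with the optimal constant is umbilic. -/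
lemma pinchAt_eq_zero (hT : 0 < T) (p : spaceTime n T) {η : ℝ} (hη : n * η = 1)
    (hp : ∀ ξ, 0 ≤ h.pinchAt hT p η ξ) (ξ : Ambient n) : h.pinchAt hT p η ξ = 0 := by
  have h1 : h.pinchMatrix hT p η = 0 := by
    rw [← (h.posSemidef_pinchMatrix hT p η hp).trace_eq_zero_iff, trace_pinchMatrix, hη, sub_self,
      zero_mul]
  rw [pinchAt_eq_dotProduct, h1, Matrix.zero_mulVec, dotProduct_zero]

/-- A nonnegative form has nonnegative trace. If `H < 0`, this leaves only `n * η ≥ 1`. -/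
lemma mul_meanCurvature_nonneg (hT : 0 < T) (p : spaceTime n T) {η : ℝ}
    (hp : ∀ ξ, 0 ≤ h.pinchAt hT p η ξ) : 0 ≤ (1 - n * η) *
      smoothOn.eval p (IsSurfaceFrame.meanCurvature (h.D hT) (coord h.smooth_normal)) := by
  rw [← h.trace_pinchMatrix hT p η]
  exact (h.posSemidef_pinchMatrix hT p η hp).trace_nonneg

end IsHypersurfaceFamily

lemma isPreconnected_spaceTime {n : ℕ} (hn : 1 ≤ n) (T : EReal) :
    IsPreconnected (spaceTime n T) := by
  refine (convex_timeInterval T).isPreconnected.prod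
    (isConnected_compl_singleton_of_one_lt_rank ?_ 0).isPreconnected
  rw [← Module.finrank_eq_rank, finrank_euclideanSpace_fin]
  exact_mod_cast Nat.lt_add_of_pos_left hn

lemma meanCurv_neg {n : ℕ} (F ν : UnitSphere n → Ambient n) (x : UnitSphere n) :
    meanCurv F (-ν) x = - meanCurv F ν x := by
  have : secondFundMatrix F (-ν) x = - secondFundMatrix F ν x := by
    ext i j
    simp only [secondFundMatrix, secondFundForm, Matrix.of_apply, Matrix.neg_apply, mvfderiv_neg,
      neg_apply, inner_neg_left]
  rw [meanCurv, meanCurv, this, Matrix.mul_neg, Matrix.trace_neg]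

namespace IsImmersedFamily

open IsHypersurfaceFamily

variable {n : ℕ} {T : EReal} {X ν : ℝ → UnitSphere n → Ambient n} (h : IsImmersedFamily n T X ν)
include h

lemma neg_normal : IsImmersedFamily n T X (-ν) where
  smooth := h.smooth
  smooth_normal := h.smooth_normal.neg
  immersion := h.immersion
  norm_normal t ht x := by
    rw [Pi.neg_apply, Pi.neg_apply, norm_neg]
    exact h.norm_normal t ht x
  normal t ht x v := by
    rw [Pi.neg_apply, Pi.neg_apply, inner_neg_right, h.normal t ht x v, neg_zero]

variable (hT : 0 < T)
include hT

lemma isPinched_iff {t : ℝ} (ht : t ∈ timeInterval T) (η : ℝ) : IsPinched η (X t) (ν t) ↔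
    ∀ p : spaceTime n T, p.1.1 = t → ∀ ξ, 0 ≤ h.isHypersurfaceFamily.pinchAt hT p η ξ := by
  constructor
  · rintro hP p rfl
    exact (h.pinchAt_nonneg_iff hT p η).2 (hP _)
  · intro hP x v
    have := (h.pinchAt_nonneg_iff hT ⟨(t, (x : Ambient n)), ht, coe_ne_zero x⟩ η).1 (hP _ rfl)
    rw [sphereProj_coe] at this
    exact this v

/-- The pinching condition with the optimal constant does not depend on the choice of the unit
normal. -/
lemma isPinched_neg_normal {t : ℝ} (ht : t ∈ timeInterval T) {η : ℝ} (hη : n * η = 1)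
    (hP : IsPinched η (X t) (ν t)) : IsPinched η (X t) (-ν t) := by
  intro x v
  have h0 := (h.isPinched_iff hT ht η).1 hP ⟨(t, (x : Ambient n)), ht, coe_ne_zero x⟩ rfl
  have h1 : ∀ v : TangentSpace (𝓡 n) (sphereProj n (x : Ambient n)),
      secondFundForm (X t) (ν t) (sphereProj n (x : Ambient n)) v v
      - η * meanCurv (X t) (ν t) (sphereProj n (x : Ambient n))
        * inducedMetric (X t) (sphereProj n (x : Ambient n)) v v = 0 := fun v =>
    (h.pinchAt_mvfderiv hT ⟨(t, (x : Ambient n)), ht, coe_ne_zero x⟩ η v).symm.trans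
      (h.isHypersurfaceFamily.pinchAt_eq_zero hT _ hη h0 _)
  rw [sphereProj_coe] at h1
  have h2 : secondFundForm (X t) (-ν t) x v v = - secondFundForm (X t) (ν t) x v v := by
    simp only [secondFundForm, mvfderiv_neg, neg_apply, inner_neg_left]
  rw [meanCurv_neg, h2]
  linarith [h1 v]

/-- Space-time is connected, since removing a point from a space of dimension at least two leaves it
connected; the intermediate value theorem then applies to the nonvanishing function `H`. -/
lemma meanCurv_pos_or_neg (hn : 1 ≤ n)
    (hH : ∀ t ∈ timeInterval T, ∀ x, meanCurv (X t) (ν t) x ≠ 0) :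
    (∀ t ∈ timeInterval T, ∀ x, 0 < meanCurv (X t) (ν t) x) ∨
      ∀ t ∈ timeInterval T, ∀ x, meanCurv (X t) (ν t) x < 0 := by
  set f := smoothOn.ext (IsSurfaceFrame.meanCurvature (h.isHypersurfaceFamily.D hT)
    (coord h.isHypersurfaceFamily.smooth_normal)) with hf
  have hfc : ContinuousOn f (spaceTime n T) := (smoothOn.contDiffOn_ext _).continuousOn
  have hfe : ∀ p : spaceTime n T, f p = meanCurv (X p.1.1) (ν p.1.1) (sphereProj n p.1.2) := by
    intro p
    rw [← h.eval_meanCurvature hT, hf, smoothOn.ext_apply]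
    rfl
  have hf0 : ∀ p ∈ spaceTime n T, f p ≠ 0 := fun p hp => by
    rw [hfe ⟨p, hp⟩]
    exact hH _ hp.1 _
  have hfx : ∀ t ∈ timeInterval T, ∀ x : UnitSphere n,
      (t, (x : Ambient n)) ∈ spaceTime n T ∧ f (t, (x : Ambient n)) = meanCurv (X t) (ν t) x := by
    intro t ht x
    refine ⟨⟨ht, coe_ne_zero x⟩, ?_⟩
    rw [hfe ⟨(t, (x : Ambient n)), ht, coe_ne_zero x⟩, sphereProj_coe]
  by_contra! hcon
  obtain ⟨⟨t, ht, x, hx⟩, s, hs, y, hy⟩ := hcon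
  rw [← (hfx t ht x).2] at hx
  rw [← (hfx s hs y).2] at hy
  obtain ⟨p, hp, hp0⟩ := (isPreconnected_spaceTime hn T).intermediate_value (hfx t ht x).1
    (hfx s hs y).1 hfc ⟨hx, hy⟩
  exact hf0 p hp hp0

lemma isFlowFamily {κ : ℝ} (hH : ∀ t ∈ timeInterval T, ∀ x, 0 < meanCurv (X t) (ν t) x)
    (hX : ∀ t ∈ timeInterval T, ∀ x, HasDerivWithinAt (fun s => X s x)
      ((meanCurv (X t) (ν t) x)⁻¹ • ν t x - κ • X t x) (timeInterval T) t) :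
    IsFlowFamily n T (extendFamily X) (extendFamily ν) hT κ where
  toIsHypersurfaceFamily := h.isHypersurfaceFamily
  meanCurvature_pos p := by
    rw [h.eval_meanCurvature hT]
    exact hH _ p.2.1 _
  evolution p := by
    rw [h.eval_meanCurvature hT]
    exact fderivWithin_extendFamily_time h.smooth p.2 hT (hX _ p.2.1 _)

lemma isPinched_of_pos (hn : 1 ≤ n) {ε κ : ℝ} (hε0 : 0 ≤ ε) (hε1 : n * ε ≤ 1)
    (hH : ∀ t ∈ timeInterval T, ∀ x, 0 < meanCurv (X t) (ν t) x)
    (hX : ∀ t ∈ timeInterval T, ∀ x, HasDerivWithinAt (fun s => X s x)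
      ((meanCurv (X t) (ν t) x)⁻¹ • ν t x - κ • X t x) (timeInterval T) t)
    (h0 : IsPinched ε (X 0) (ν 0)) {t : ℝ} (ht : t ∈ timeInterval T) :
    IsPinched ε (X t) (ν t) :=
  (h.isPinched_iff hT ht ε).2 fun p _ ξ =>
    (h.isFlowFamily hT hH hX).pinchAt_nonneg hn hε0 hε1
      (fun p q _ hr h1 h2 η ξ hξ => (h.pinchAt_eq_of_smul hT p q hr h1 h2 η ξ).symm ▸ hξ)
      ((h.isPinched_iff hT (zero_mem_timeInterval hT) ε).1 h0) p ξ

/-- Pinching is preserved by the flow `∂X/∂t = H⁻¹ ν - κ X`. -/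
theorem isPinched (hn : 1 ≤ n) {ε κ : ℝ} (hε0 : 0 ≤ ε) (hε1 : n * ε ≤ 1)
    (hH : ∀ t ∈ timeInterval T, ∀ x, meanCurv (X t) (ν t) x ≠ 0)
    (hX : ∀ t ∈ timeInterval T, ∀ x, HasDerivWithinAt (fun s => X s x)
      ((meanCurv (X t) (ν t) x)⁻¹ • ν t x - κ • X t x) (timeInterval T) t)
    (h0 : IsPinched ε (X 0) (ν 0)) {t : ℝ} (ht : t ∈ timeInterval T) :
    IsPinched ε (X t) (ν t) := by
  rcases h.meanCurv_pos_or_neg hT hn hH with hpos | hneg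
  · exact h.isPinched_of_pos hT hn hε0 hε1 hpos hX h0 ht
  have ht0 := zero_mem_timeInterval hT
  have hε : n * ε = 1 := by
    let x : UnitSphere n := sphereProj n 0
    have h1 := h.isHypersurfaceFamily.mul_meanCurvature_nonneg hT
      ⟨(0, (x : Ambient n)), ht0, coe_ne_zero x⟩ ((h.isPinched_iff hT ht0 ε).1 h0 _ rfl)
    rw [h.eval_meanCurvature hT] at h1
    nlinarith [hneg 0 ht0 (sphereProj n (x : Ambient n))]
  -- Changing the sign of `ν` changes that of `H` but not the velocity `H⁻¹ν`, and with `nε = 1`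
  -- pinching holds for either normal. The positive case therefore applies to `-ν`.
  have h1 : IsPinched ε (X t) ((-ν) t) := by
    refine h.neg_normal.isPinched_of_pos (κ := κ) hT hn hε0 hε1 (fun s hs x => ?_)
      (fun s hs x => ?_) (h.isPinched_neg_normal hT ht0 hε h0) ht
    · rw [Pi.neg_apply, meanCurv_neg]
      exact neg_pos.2 (hneg s hs x)
    · rw [Pi.neg_apply, meanCurv_neg, Pi.neg_apply, inv_neg, neg_smul_neg]
      exact hX s hs x
  have h2 := h.neg_normal.isPinched_neg_normal hT ht hε h1
  rwa [Pi.neg_apply, neg_neg] at h2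

end IsImmersedFamily

/-! ### Specialization to the two flows -/

lemma IsEvolvingHypersurface.isImmersedFamily {n : ℕ} {T : EReal}
    {X ν : ℝ → UnitSphere n → Ambient n} (h : IsEvolvingHypersurface n T X ν) :
    IsImmersedFamily n T X ν :=
  ⟨h.smooth, h.smooth_normal, h.immersion, h.norm_normal, h.normal⟩

theorem proposition3p6 (n : ℕ) (hn : 1 ≤ n) (T : EReal) (hT : 0 < T)
    (ε : ℝ) (hε₀ : 0 ≤ ε) (hε₁ : ε ≤ 1 / (n : ℝ)) :
    (∀ X ν : ℝ → UnitSphere n → Ambient n, IsInverseMeanCurvatureFlow n T X ν →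
      IsPinched ε (X 0) (ν 0) → ∀ t ∈ timeInterval T, IsPinched ε (X t) (ν t)) ∧
    (∀ X ν : ℝ → UnitSphere n → Ambient n, IsRescaledInverseMeanCurvatureFlow n T X ν →
      IsPinched ε (X 0) (ν 0) → ∀ t ∈ timeInterval T, IsPinched ε (X t) (ν t)) := by
  have hn0 : (0 : ℝ) < n := by exact_mod_cast hn
  have hε : n * ε ≤ 1 := by
    rwa [le_div_iff₀ hn0, mul_comm] at hε₁
  constructor
  · intro X ν h h0 t ht
    refine h.isImmersedFamily.isPinched hT hn (κ := 0) hε₀ hε h.meanCurv_ne_zero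
      (fun s hs x => ?_) h0 ht
    rw [zero_smul, sub_zero]
    exact h.evolution s hs x
  · intro X ν h h0 t ht
    refine h.isImmersedFamily.isPinched hT hn (κ := 1 / n) hε₀ hε h.meanCurv_ne_zero
      (fun s hs x => ?_) h0 ht
    rw [sub_eq_neg_add, ← neg_smul]
    exact h.evolution s hs x
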